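/- Let $k\ge 2$. A hypergraph $(H,E)$ of arity $k$, $E\subseteq H^k$, is called $k$-full if $E$ is symmetric and contains every $k$-tuple with a repeated entry. A template of arity $k$ is a sequence $\mathcal H=\langle \mathbf h_n=(H_n,E_n):n<\omega\rangle$ of finite $k$-full hypergraphs, with vertex set $\{0,\dots,H_n-1\}$, for which there is a function $f:\omega\to\omega\setminus\{0\}$ with $\lim_n f(n)=\infty$, $f(n)\le H_n$ for all $n$, and the extension property: for every $n$ and any $t=f(n)$ many $(k-1)$-tuples $(i^\ell_0,\dots,i^\ell_{k-2})$, $\ell<t$, from $H_n$, there is $s\in H_n$ with $(s,i^\ell_0,\dots,i^\ell_{k-2})\in E_n$ for all $\ell<t$. Let $X_{\mathcal H}$ be the set of finite sequences $\eta$ of natural numbers with $\eta(n)<H_n$ for all $n<\operatorname{lgn}(\eta)$. Let $\mathcal L$ be the language with a $k$-place relation $R$ and unary predicates $Q_\eta$ ($\eta\in X_{\mathcal H}$), and let $T_0=T_0(\mathcal H)$ be the universal $\mathcal L$-theory which says that * $R$ is symmetric and holds only on tuples of distinct elements; * $Q_{\langle\rangle}$ holds of everything, and $Q_\nu\subseteq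 Q_\eta$ whenever $\eta$ is an initial segment of $\nu$; * for every $\eta$ of length $m$, the predicates $Q_{\eta^\frown\langle i\rangle}$, $i<H_m$, are pairwise disjoint and cover $Q_\eta$; * whenever $\eta_0,\dots,\eta_{k-1}\in X_{\mathcal H}$, $n<\min_i\operatorname{lgn}(\eta_i)$ and $(\eta_0(n),\dots,\eta_{k-1}(n))\notin E_n$, there is no $R$-edge $(x_0,\dots,x_{k-1})$ with $x_i\in Q_{\eta_i}$ for all $i<k$. For $m<\omega$ let $\mathcal L_m\subseteq\mathcal L$ consist of $R$ and the $Q_\eta$ with $\operatorname{lgn}(\eta)\le m$, and let $T_0^m$ be the restriction of $T_0$ to $\mathcal L_m$, i.e. the axioms of $T_0$ in this language. A theory $T'\supseteq T_0'$ in the same language (containment up to consequences) is a model completion of $T_0'$ if for every model $M$ of $T_0'$ the theory $T'\cup\operatorname{Diag}(M)$ is complete (and consistent), where $\operatorname{Diag}(M)$ is the quantifier-free diagram of $M$. **Theorem.** For every template $\mathcal H$ of arity $k\geq 2$, the theory $T_0(\mathcal H)$ has a model completion $T=T(\mathcal H)$, which is unique up to logical equivalence. $T$ eliminates quantifiers,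 $T$ is simple (no formula has the tree property), and $T$ has rank $1$ (the maximum of the $SU$-ranks of complete $1$-types over $\emptyset$ is $1$). Moreover, each $T_0^m$ has a model completion $T^m$, and $T$ is the limit of $\langle T^m:m<\omega\rangle$: for every $\mathcal L$-sentence $\varphi$, for all sufficiently large $m$, $\varphi$ is an $\mathcal L_m$-sentence and $T^m\vdash\varphi$ if and only if $T\vdash\varphi$. -/

import Mathlib

open FirstOrder Filter

universe u v w

/-! ### General model theory -/

namespace FirstOrder.Language

variable (L : Language.{u, v})

/-- The (quantifier-free) diagram of a structure `M`, with the elements of `M` as new constants. -/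
def qfDiagram (M : Type w) [L.Structure M] : L[[M]].Theory :=
  {φ | BoundedFormula.IsQF φ ∧ M ⊨ φ}

/-- The tuples `c` and `d` have the same type over the parameter set `A`. -/
def SameTypeOver {N : Type w} [L.Structure N] (A : Set N) {β : Type} (c d : β → N) : Prop :=
  ∀ θ : L.Formula (A ⊕ β),
    θ.Realize (Sum.elim (fun a : A => (a : N)) c) ↔ θ.Realize (Sum.elim (fun a : A => (a : N)) d)

/-- The formula `φ(x̄, d)` divides over `A`: in some elementary extension there are infinitely many
realizations `c i` of `tp(d / A)` such that the family `φ(x̄, c i)` is `q`-inconsistent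
for some finite `q`. -/
def Divides {N : Type w} [L.Structure N] {a b : ℕ} (A : Set N)
    (φ : L.Formula (Fin a ⊕ Fin b)) (d : Fin b → N) : Prop :=
  ∃ (N' : Type w) (_ : L.Structure N') (g : N ↪ₑ[L] N') (q : ℕ) (c : ℕ → Fin b → N'),
    (∀ i, L.SameTypeOver (g '' A) (c i) (g ∘ d)) ∧
    ∀ s : Finset ℕ, s.card = q →
      ¬ ∃ x : Fin a → N', ∀ i ∈ s, φ.Realize (Sum.elim x (c i))

/-- The formula `φ(x̄, d)` forks over `A`: in some elementary extension it implies a finite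
disjunction of formulas each of which divides over `A`. -/
def Forks {N : Type w} [L.Structure N] {a b : ℕ} (A : Set N)
    (φ : L.Formula (Fin a ⊕ Fin b)) (d : Fin b → N) : Prop :=
  ∃ (N' : Type w) (_ : L.Structure N') (g : N ↪ₑ[L] N') (n : ℕ) (b' : Fin n → ℕ)
    (ψ : ∀ j, L.Formula (Fin a ⊕ Fin (b' j))) (e : ∀ j, Fin (b' j) → N'),
    (∀ j, L.Divides (g '' A) (ψ j) (e j)) ∧
    ∀ x : Fin a → N', φ.Realize (Sum.elim x (g ∘ d)) → ∃ j, (ψ j).Realize (Sum.elim x (e j))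

/-- The complete type `tp(c / B)` of an element `c` forks over `A`. -/
def TypeForks {N : Type w} [L.Structure N] (A B : Set N) (c : N) : Prop :=
  ∃ (b : ℕ) (φ : L.Formula (Fin 1 ⊕ Fin b)) (d : Fin b → N),
    (∀ i, d i ∈ B) ∧ φ.Realize (Sum.elim (fun _ => c) d) ∧ L.Forks A φ d

/-- `SU(c / A) ≥ n`, for finite `n`: `SU(p) ≥ n + 1` iff `p` has a forking extension `q`
with `SU(q) ≥ n`. -/
def SURankGE : ℕ → ∀ (M : Type w) [L.Structure M], Set M → M → Prop
  | 0, _, _, _, _ => True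
  | n + 1, M, _, A, c =>
    ∃ (N : Type w) (_ : L.Structure N) (f : M ↪ₑ[L] N) (B : Set N) (c' : N),
      f '' A ⊆ B ∧
      L.SameTypeOver (f '' A) (fun _ : Fin 1 => c') (fun _ : Fin 1 => f c) ∧
      L.TypeForks (f '' A) B c' ∧ SURankGE n N B c'

variable {L}

/-- `T` is a model completion of `T₀`: it extends `T₀`, and for every model `M` of `T₀` the theory
`T ∪ Diag(M)` is complete (in particular it is consistent). -/
def IsModelCompletion (T₀ T : L.Theory) : Prop :=
  (∀ φ ∈ T₀, T ⊨ᵇ φ) ∧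
  ∀ M : Theory.ModelType.{u, v, w} T₀,
    ((L.lhomWithConstants M).onTheory T ∪ L.qfDiagram M).IsComplete

/-- Two theories are (logically) equivalent: they have the same consequences. -/
def TheoryEquiv (T T' : L.Theory) : Prop :=
  ∀ φ : L.Sentence, T ⊨ᵇ φ ↔ T' ⊨ᵇ φ

/-- Every formula is equivalent modulo `T` to a quantifier-free one in the same variables. -/
def EliminatesQuantifiers (T : L.Theory) : Prop :=
  ∀ (n : ℕ) (φ : L.Formula (Fin n)),
    ∃ ψ : L.Formula (Fin n), BoundedFormula.IsQF ψ ∧ T ⊨ᵇ φ.iff ψ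

/-- The formula `φ(x̄, ȳ)` has the tree property in `T`: some model has parameters indexed by the
tree of finite sequences of natural numbers such that the formulas at the immediate successors of
any node are `q`-inconsistent, while along any branch the formulas are (finitely) consistent. -/
def HasTreeProperty (T : L.Theory) {a b : ℕ} (φ : L.Formula (Fin a ⊕ Fin b)) : Prop :=
  ∃ (M : Theory.ModelType.{u, v, w} T) (p : List ℕ → Fin b → M) (q : ℕ),
    (∀ (η : List ℕ) (s : Finset ℕ), s.card = q →
      ¬ ∃ x : Fin a → M, ∀ i ∈ s, φ.Realize (Sum.elim x (p (η ++ [i])))) ∧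
    ∀ (σ : ℕ → ℕ) (n : ℕ),
      ∃ x : Fin a → M, ∀ j < n, φ.Realize (Sum.elim x (p (List.ofFn fun i : Fin (j + 1) => σ i)))

/-- `T` is simple: no formula has the tree property. -/
def IsSimpleTheory (T : L.Theory) : Prop :=
  ∀ (a b : ℕ) (φ : L.Formula (Fin a ⊕ Fin b)), ¬ HasTreeProperty.{u, v, w} T φ

/-- `T` has (finite) SU-rank `n`: this is the maximum of the SU-ranks of the complete `1`-types
over the empty set. -/
def HasSURank (T : L.Theory) (n : ℕ) : Prop :=
  (∃ (M : Theory.ModelType.{u, v, w} T) (c : M), L.SURankGE n M ∅ c) ∧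
  ∀ (M : Theory.ModelType.{u, v, w} T) (c : M), ¬ L.SURankGE (n + 1) M ∅ c

end FirstOrder.Language

/-! ### Templates -/

/-- A sequence of finite hypergraphs of arity `r + 1`; the vertex set of the `n`-th one is
`{0, …, size n - 1}`. -/
structure HypergraphSeq (r : ℕ) where
  size : ℕ → ℕ
  E : ∀ n, Set (Fin (r + 1) → Fin (size n))

namespace HypergraphSeq

variable {r : ℕ} (H : HypergraphSeq r)

/-- The `n`-th hypergraph is full: its edge relation is symmetric and it holds on all tuples with
a repetition. -/
def IsFull (n : ℕ) : Prop :=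
  (∀ (σ : Equiv.Perm (Fin (r + 1))), ∀ e ∈ H.E n, e ∘ σ ∈ H.E n) ∧
  ∀ e : Fin (r + 1) → Fin (H.size n), ¬ Function.Injective e → e ∈ H.E n

/-- The pair `(H, f)` is a template of arity `r + 1`. -/
structure IsTemplateWith (f : ℕ → ℕ) : Prop where
  two_le_arity : 2 ≤ r + 1
  pos : ∀ n, f n ≠ 0
  tendsto : Tendsto f atTop atTop
  full : ∀ n, H.IsFull n
  le_size : ∀ n, f n ≤ H.size n
  extension : ∀ (n : ℕ) (i : Fin (f n) → Fin r → Fin (H.size n)),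
    ∃ s : Fin (H.size n), ∀ l, (Fin.cons s (i l) : Fin (r + 1) → Fin (H.size n)) ∈ H.E n

def IsTemplate : Prop := ∃ f : ℕ → ℕ, H.IsTemplateWith f

/-! ### The languages and the universal theories

`N = ⊤` gives the full language and theory, and `N = m` their restrictions to the predicates
indexed by sequences of length at most `m`. -/

/-- `η` belongs to the tree of finite sequences of vertices. -/
def InTree (η : List ℕ) : Prop := ∀ (n : ℕ) (h : n < η.length), η[n] < H.size n

/-- The sequences in the tree of length at most `N`. -/
def Node (N : ℕ∞) : Type := {η : List ℕ // H.InTree η ∧ (η.length : ℕ∞) ≤ N}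

variable {H} in
/-- The vertex `η(n)` of the `n`-th hypergraph. -/
def Node.vertex {N : ℕ∞} (η : H.Node N) (n : ℕ) (h : n < η.1.length) : Fin (H.size n) :=
  ⟨η.1[n], η.2.1 n h⟩

/-- The empty sequence. -/
def root (N : ℕ∞) : H.Node N := ⟨[], by simp [InTree]⟩

variable {H} in
/-- The sequence `η⌢⟨i⟩`. -/
def Node.child {N : ℕ∞} (η : H.Node N) (h : ((η.1.length + 1 : ℕ) : ℕ∞) ≤ N)
    (i : Fin (H.size η.1.length)) : H.Node N :=
  ⟨η.1 ++ [(i : ℕ)], by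
    refine ⟨fun n hn => ?_, by simpa using h⟩
    rcases Nat.lt_or_ge n η.1.length with hlt | hge
    · rw [List.getElem_append_left hlt]
      exact η.2.1 n hlt
    · have hn' : n = η.1.length := by
        simp only [List.length_append, List.length_singleton] at hn
        omega
      subst hn'
      simp⟩

/-- The relation symbols: one `(r + 1)`-place symbol `R` and unary predicates `Q η`. -/
inductive Rel (N : ℕ∞) : ℕ → Type
  | R : Rel N (r + 1)
  | Q (η : H.Node N) : Rel N 1

/-- The language with symbols `R` and `Q η` for `η` of length at most `N`. -/
def language (N : ℕ∞) : FirstOrder.Language.{0, 0} := ⟨fun _ => Empty, H.Rel N⟩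

/-- The atomic formula `R(x_{s 0}, …, x_{s r})`. -/
def relR (N : ℕ∞) {n : ℕ} (s : Fin (r + 1) → Fin n) : (H.language N).BoundedFormula Empty n :=
  FirstOrder.Language.Relations.boundedFormula (L := H.language N) (Rel.R : H.Rel N (r + 1)) fun i => &(s i)

variable {H} in
/-- The atomic formula `Q_η(x_i)`. -/
def predQ {N : ℕ∞} (η : H.Node N) {n : ℕ} (i : Fin n) : (H.language N).BoundedFormula Empty n :=
  FirstOrder.Language.Relations.boundedFormula (L := H.language N) (Rel.Q η : H.Rel N 1) fun _ => &i

/-- The universal theory `T₀` (for `N = ⊤`) and its restriction to the language of level `m`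
(for `N = m`). -/
def baseTheory (N : ℕ∞) : (H.language N).Theory :=
  -- `R` is symmetric
  {φ | ∃ σ : Equiv.Perm (Fin (r + 1)), φ = (H.relR N id ⟹ H.relR N σ).alls} ∪
  -- `R` holds only on tuples of distinct elements
  {φ | ∃ i j : Fin (r + 1), i ≠ j ∧
    φ = ((FirstOrder.Language.Term.bdEqual (&i) (&j)) ⟹ ∼(H.relR N id)).alls} ∪
  -- `Q_⟨⟩` names everything
  {(predQ (H.root N) (0 : Fin 1)).alls} ∪
  -- `Q_ν` refines `Q_η` if `η` is an initial segment of `ν`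
  {φ | ∃ η ν : H.Node N, η.1 <+: ν.1 ∧ φ = (predQ ν (0 : Fin 1) ⟹ predQ η 0).alls} ∪
  -- the predicates at the children of `η` are disjoint
  {φ | ∃ (η : H.Node N) (h : ((η.1.length + 1 : ℕ) : ℕ∞) ≤ N) (i j : Fin (H.size η.1.length)),
    i ≠ j ∧ φ = (∼(predQ (η.child h i) (0 : Fin 1) ⊓ predQ (η.child h j) 0)).alls} ∪
  -- the predicates at the children of `η` cover `Q_η`
  {φ | ∃ (η : H.Node N) (h : ((η.1.length + 1 : ℕ) : ℕ∞) ≤ N),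
    φ = (predQ η (0 : Fin 1) ⟹
      FirstOrder.Language.BoundedFormula.iSup fun i => predQ (η.child h i) 0).alls} ∪
  -- edges forbidden by the `n`-th hypergraph
  {φ | ∃ (η : Fin (r + 1) → H.Node N) (n : ℕ) (h : ∀ i, n < (η i).1.length),
    (fun i => (η i).vertex n (h i)) ∉ H.E n ∧
    φ = ((FirstOrder.Language.BoundedFormula.iInf fun i => predQ (η i) i) ⟹ ∼(H.relR N id)).alls}

/-- The inclusion of the language of level `m` into the full language. -/
def incl (m : ℕ) : H.language m →ᴸ H.language ⊤ where
  onFunction := fun _ f => f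
  onRelation := fun _ s => match s with
    | .R => .R
    | .Q η => .Q ⟨η.1, η.2.1, le_top⟩

/-- `T` is the limit of the theories `Tm m` in the languages of level `m`: every sentence `φ` of
the full language belongs to the language of level `m` for all large enough `m`, and for all large
enough `m` it follows from `Tm m` if and only if it follows from `T`. -/
def IsLimit (Tm : ∀ m : ℕ, (H.language m).Theory) (T : (H.language ⊤).Theory) : Prop :=
  ∀ φ : (H.language ⊤).Sentence, ∀ᶠ m : ℕ in atTop,
    ∃ ψ : (H.language m).Sentence, (H.incl m).onSentence ψ = φ ∧ (Tm m ⊨ᵇ ψ ↔ T ⊨ᵇ φ)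

end HypergraphSeq

namespace HypergraphSeq

variable {r : ℕ} {H : HypergraphSeq r}

/-! ### Colored hypergraphs -/

/-! A model of $T_0$ is a hypergraph in which every vertex carries a branch of the tree, its color,
such that the colors of an edge form, at every level, an edge of the template. The axioms of the
model completion demand that, over a finite set $F$, every consistent edge pattern be realized by a
new vertex with prescribed colors below a level $l$. This is first-order although a color is an
infinite object: if $l$ is so large that from `l` on any $|F|$ vertices of the template have a
common join (`HasJoins`), then the higher levels of the color can always be chosen, and consistency
concerns only the levels below $l$. Since $f(n)\to\infty$, such an $l$ exists for every $|F|$. The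
restricted theories $T_0^m$ are treated in the same way, with all colors cut off at a level `N`.

Every colored hypergraph embeds in a generic one, obtained freely by adding vertices for all finite
patterns (`GenericExt.isGeneric`). Between generic hypergraphs a back and forth argument works for
finite partial isomorphisms that preserve colors only up to a level depending on the formula
(`exists_agree_level`). Hence the truth of a formula is determined by finitely many atomic formulas.
This yields completeness, quantifier elimination, the model completion and, by comparing generic
hypergraphs of different levels, the limit statement. A model of any other model completion is
existentially closed in its generic extension, so it satisfies the extension axioms; uniqueness
follows.

Simplicity and rank rest on free amalgamation (`exists_amalgam`, `exists_realize_of_agree`): a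
solution of $\varphi(x,c)$ can be copied over many lookalikes of $c$ at once, unless $x$ meets $c$
in a point that has to move. So dividing is caused by equality alone, a forking type is realized
inside its domain, and no second forking is possible. A branch of parameters can meet the finitely
many entries of $x$ anew only finitely often, which excludes the tree property. -/

theorem exists_perm_succ {σ : Equiv.Perm (Fin (r + 1))} (h : σ 0 = 0) :
    ∃ τ : Equiv.Perm (Fin r), ∀ i, σ i.succ = (τ i).succ := by
  obtain ⟨⟨p, τ⟩, rfl⟩ := Equiv.Perm.decomposeFin.symm.surjective σ
  have hp : p = 0 := by simpa using h
  subst hp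
  exact ⟨τ, fun i => by simp⟩

variable (H) in
/-- A hypergraph on `M` together with a branch of the tree for each vertex. -/
structure ColoredHypergraph (M : Type*) where
  color : M → ∀ j, Fin (H.size j)
  edge : (Fin (r + 1) → M) → Prop

variable (H) in
/-- From level `l` on and below level `N`, any family of `k ≤ n` vertices admits a vertex joined
to all `r`-tuples from the family. -/
def HasJoins (N : ℕ∞) (l n : ℕ) : Prop :=
  ∀ k ≤ n, ∀ j, l ≤ j → (j : ℕ∞) < N → ∀ c : Fin k → Fin (H.size j),
    ∃ s : Fin (H.size j), ∀ u : Fin r → Fin k,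
      (Fin.cons s (c ∘ u) : Fin (r + 1) → Fin (H.size j)) ∈ H.E j

theorem HasJoins.mono {N N' : ℕ∞} {l l' n n' : ℕ} (h : H.HasJoins N l n) (hN : N' ≤ N)
    (hl : l ≤ l') (hn : n' ≤ n) : H.HasJoins N' l' n' :=
  fun k hk j hj hjN => h k (hk.trans hn) j (hl.trans hj) (hjN.trans_le hN)

theorem IsTemplate.size_pos (hH : H.IsTemplate) (n : ℕ) : 0 < H.size n := by
  obtain ⟨f, hf⟩ := hH
  exact (Nat.pos_of_ne_zero (hf.pos n)).trans_le (hf.le_size n)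

theorem IsTemplate.symm (hH : H.IsTemplate) (n : ℕ) (σ : Equiv.Perm (Fin (r + 1)))
    {e : Fin (r + 1) → Fin (H.size n)} (he : e ∈ H.E n) : e ∘ σ ∈ H.E n := by
  obtain ⟨f, hf⟩ := hH
  exact (hf.full n).1 σ e he

/-- A family of `k ≤ n` vertices has at most `n ^ r` many `r`-tuples, and `f` is eventually at least
that large. -/
theorem IsTemplate.exists_hasJoins (hH : H.IsTemplate) (n : ℕ) : ∃ l, H.HasJoins ⊤ l n := by
  obtain ⟨f, hf⟩ := id hH
  obtain ⟨l, hl⟩ := (hf.tendsto.eventually_ge_atTop (n ^ r)).exists_forall_of_atTop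
  refine ⟨l, fun k hk j hj _ c => ?_⟩
  have hcard : Fintype.card (Fin r → Fin k) ≤ f j := by
    simpa using (Nat.pow_le_pow_left hk r).trans (hl j hj)
  have : NeZero (H.size j) := ⟨(hH.size_pos j).ne'⟩
  -- The extension property takes exactly `f j` tuples, so the list is padded with a constant one.
  let g : Fin (f j) → Fin r → Fin (H.size j) := fun i =>
    if h : (i : ℕ) < Fintype.card (Fin r → Fin k) then
      c ∘ (Fintype.equivFin (Fin r → Fin k)).symm ⟨i, h⟩ else 0
  obtain ⟨s, hs⟩ := hf.extension j g
  refine ⟨s, fun u => ?_⟩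
  have hu : (Fintype.equivFin (Fin r → Fin k) u : ℕ) < k ^ r := by
    simpa using (Fintype.equivFin (Fin r → Fin k) u).is_lt
  simpa [g, hu] using hs ⟨Fintype.equivFin _ u, (Fin.is_lt _).trans_le hcard⟩

namespace ColoredHypergraph

variable {M : Type*} {M' : Type*} {M'' : Type*}

/-- The properties of the colored hypergraphs that come from models of `T₀` of level `N`. The
colors at the levels from `N` on are irrelevant and normalized to be `0`. -/
structure IsBase (N : ℕ∞) (C : H.ColoredHypergraph M) : Prop where
  symm : ∀ (σ : Equiv.Perm (Fin (r + 1))) x, C.edge x → C.edge (x ∘ σ)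
  inj : ∀ x, C.edge x → Function.Injective x
  compat : ∀ x, C.edge x → ∀ j : ℕ, (j : ℕ∞) < N → (fun i => C.color (x i) j) ∈ H.E j
  zero : ∀ x (j : ℕ), N ≤ j → (C.color x j : ℕ) = 0

/-- The extension property of the colored hypergraphs that come from models of the model
completion of level `N`. -/
structure IsGeneric (N : ℕ∞) (C : H.ColoredHypergraph M) : Prop extends C.IsBase N where
  extension : ∀ (F : Finset M) (P : Set (Fin r → M)) (l : ℕ) (β : ∀ j, Fin (H.size j)),
    (l : ℕ∞) ≤ N → H.HasJoins N l F.card →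
    (∀ u ∈ P, ∀ σ : Equiv.Perm (Fin r), u ∘ σ ∈ P) → (∀ u ∈ P, Function.Injective u) →
    (∀ u ∈ P, (∀ i, u i ∈ F) → ∀ j < l,
      (Fin.cons (β j) (fun i => C.color (u i) j) : Fin (r + 1) → Fin (H.size j)) ∈ H.E j) →
    ∃ y ∉ F, (∀ j < l, C.color y j = β j) ∧
      ∀ u : Fin r → M, (∀ i, u i ∈ F) → (C.edge (Fin.cons y u) ↔ u ∈ P)

theorem IsBase.edge_comp_iff {N : ℕ∞} {C : H.ColoredHypergraph M} (hC : C.IsBase N)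
    (σ : Equiv.Perm (Fin (r + 1))) (x : Fin (r + 1) → M) : C.edge (x ∘ σ) ↔ C.edge x := by
  refine ⟨fun h => ?_, hC.symm σ x⟩
  have := hC.symm σ⁻¹ _ h
  rwa [Function.comp_assoc, ← Equiv.Perm.coe_mul, mul_inv_cancel, Equiv.Perm.coe_one,
    Function.comp_id] at this

/-- The pairs in `S` form a partial isomorphism, as far as equality, the edges, and the colors at
the levels below `l` are concerned. -/
structure Agree (l : ℕ) (C : H.ColoredHypergraph M) (C' : H.ColoredHypergraph M')
    (S : Set (M × M')) : Prop where
  eq_iff : ∀ p ∈ S, ∀ p' ∈ S, p.1 = p'.1 ↔ p.2 = p'.2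
  color : ∀ p ∈ S, ∀ j < l, C.color p.1 j = C'.color p.2 j
  edge : ∀ u : Fin (r + 1) → M × M', (∀ i, u i ∈ S) →
    (C.edge (fun i => (u i).1) ↔ C'.edge (fun i => (u i).2))

/-! ### Extending finite partial isomorphisms. -/

section Agree

variable {C : H.ColoredHypergraph M} {C' : H.ColoredHypergraph M'} {C'' : H.ColoredHypergraph M''}

theorem Agree.mono {l l' : ℕ} {S S' : Set (M × M')} (h : Agree l C C' S) (hl : l' ≤ l)
    (hS : S' ⊆ S) : Agree l' C C' S' :=
  ⟨fun p hp p' hp' => h.eq_iff p (hS hp) p' (hS hp'),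
    fun p hp j hj => h.color p (hS hp) j (hj.trans_le hl), fun u hu => h.edge u fun i => hS (hu i)⟩

theorem Agree.symm {l : ℕ} {S : Set (M × M')} (h : Agree l C C' S) :
    Agree l C' C (Prod.swap ⁻¹' S) :=
  ⟨fun p hp p' hp' => (h.eq_iff p.swap hp p'.swap hp').symm,
    fun p hp j hj => (h.color p.swap hp j hj).symm,
    fun u hu => (h.edge (fun i => (u i).swap) hu).symm⟩

theorem agree_range_iff {V : Type*} {l : ℕ} {c : V → M} {d : V → M'} :
    Agree l C C' (Set.range fun i => (c i, d i)) ↔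
      (∀ i j, c i = c j ↔ d i = d j) ∧ (∀ i, ∀ j < l, C.color (c i) j = C'.color (d i) j) ∧
      ∀ u : Fin (r + 1) → V, C.edge (c ∘ u) ↔ C'.edge (d ∘ u) := by
  constructor
  · intro h
    exact ⟨fun i j => h.eq_iff _ ⟨i, rfl⟩ _ ⟨j, rfl⟩, fun i => h.color _ ⟨i, rfl⟩,
      fun u => h.edge (fun i => (c (u i), d (u i))) fun i => ⟨u i, rfl⟩⟩
  · rintro ⟨h1, h2, h3⟩
    refine ⟨?_, ?_, fun u hu => ?_⟩
    · rintro _ ⟨i, rfl⟩ _ ⟨j, rfl⟩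
      exact h1 i j
    · rintro _ ⟨i, rfl⟩
      exact h2 i
    · choose w hw using hu
      obtain rfl : (fun i => (c (w i), d (w i))) = u := funext hw
      exact h3 w

theorem Agree.trans_range {V : Type*} {l : ℕ} {c : V → M} {d : V → M'} {e : V → M''}
    (h : Agree l C C' (Set.range fun i => (c i, d i)))
    (h' : Agree l C' C'' (Set.range fun i => (d i, e i))) :
    Agree l C C'' (Set.range fun i => (c i, e i)) := by
  rw [agree_range_iff] at *
  exact ⟨fun i j => (h.1 i j).trans (h'.1 i j),
    fun i j hj => (h.2.1 i j hj).trans (h'.2.1 i j hj), fun u => (h.2.2 u).trans (h'.2.2 u)⟩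

/-- One step of the back and forth construction; the new point avoids a given finite set. -/
theorem IsGeneric.exists_agree_insert_avoiding {N N' : ℕ∞} {l : ℕ} (hC : C.IsBase N)
    (hC' : C'.IsGeneric N') (hN : N = N' ∨ (l : ℕ∞) ≤ N ∧ (l : ℕ∞) ≤ N') {S : Set (M × M')}
    (hS : S.Finite) (h : Agree l C C' S) (A : Finset M') {n : ℕ} (hn : S.ncard + A.card ≤ n)
    (hl : H.HasJoins ⊤ l n) {x : M} (hx : ∀ p ∈ S, p.1 ≠ x) :
    ∃ y ∉ A, Agree l C C' (insert (x, y) S) := by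
  classical
  -- The extension property is applied at level `m`, which is `l` capped by the common level `N =
  -- N'` if that is smaller. In the capped case no joins are needed, and all colors from `m` on are
  -- `0` on both sides.
  obtain ⟨m, hml, hmN, hmN', hm⟩ : ∃ m : ℕ, m ≤ l ∧ (m : ℕ∞) ≤ N ∧ (m : ℕ∞) ≤ N' ∧
      (m = l ∨ N = m ∧ N' = m) := by
    by_cases h' : (l : ℕ∞) ≤ N ∧ (l : ℕ∞) ≤ N'
    · exact ⟨l, le_rfl, h'.1, h'.2, Or.inl rfl⟩
    · obtain rfl : N = N' := hN.resolve_right h'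
      have hlt : N < l := by simpa using h'
      obtain ⟨m, rfl⟩ := ENat.ne_top_iff_exists.1 hlt.ne_top
      exact ⟨m, by exact_mod_cast hlt.le, le_rfl, le_rfl, Or.inr ⟨rfl, rfl⟩⟩
  let F : Finset M' := hS.toFinset.image Prod.snd ∪ A
  have hF : F.card ≤ n := by
    refine (Finset.card_union_le _ _).trans (le_trans ?_ hn)
    gcongr
    refine Finset.card_image_le.trans ?_
    rw [Set.ncard_eq_toFinset_card S hS]
  have hSF : ∀ p ∈ S, p.2 ∈ F := fun p hp => Finset.mem_union_left _
    (Finset.mem_image.2 ⟨p, hS.mem_toFinset.2 hp, rfl⟩)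
  -- The edges of `x` over the domain of `S`, transported along `S`.
  let P : Set (Fin r → M') := {u | ∃ w : Fin r → M × M', (∀ i, w i ∈ S) ∧
    u = (fun i => (w i).2) ∧ C.edge (Fin.cons x fun i => (w i).1)}
  have hjoins : H.HasJoins N' m F.card := by
    intro k hk j hj hjN
    rcases hm with rfl | ⟨-, rfl⟩
    · exact hl k (hk.trans hF) j hj (ENat.natCast_lt_top j)
    · exact absurd hj (not_le.2 (by exact_mod_cast hjN))
  obtain ⟨y, hyF, hyc, hye⟩ := hC'.extension F P m (C.color x) hmN' hjoins
    (by
      rintro _ ⟨w, hw, rfl, he⟩ σ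
      refine ⟨w ∘ σ, fun i => hw _, rfl, ?_⟩
      have := hC.symm (Equiv.Perm.decomposeFin.symm (0, σ)) _ he
      convert this using 1
      funext i
      refine Fin.cases ?_ (fun i => ?_) i <;> simp)
    (by
      rintro _ ⟨w, hw, rfl, he⟩ i i' hii
      have := (h.eq_iff _ (hw i) _ (hw i')).2 hii
      have := hC.inj _ he (a₁ := i.succ) (a₂ := i'.succ) (by simpa using this)
      simpa using this)
    (by
      rintro _ ⟨w, hw, rfl, he⟩ - j hj
      have := hC.compat _ he j (lt_of_lt_of_le (by exact_mod_cast hj) hmN)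
      convert this using 1
      funext i
      refine Fin.cases ?_ (fun i => ?_) i
      · simp
      · simpa using (h.color _ (hw i) j (hj.trans_le hml)).symm)
  have hyS : ∀ p ∈ S, p.2 ≠ y := fun p hp hpy => hyF (hpy ▸ hSF p hp)
  refine ⟨y, fun hyA => hyF (Finset.mem_union_right _ hyA), ?_, ?_, ?_⟩
  · rintro p (rfl | hp) p' (rfl | hp')
    · simp
    · simp [(hx p' hp').symm, (hyS p' hp').symm]
    · simp [hx p hp, hyS p hp]
    · exact h.eq_iff p hp p' hp'
  · rintro p (rfl | hp) j hj
    · by_cases hjm : j < m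
      · exact (hyc j hjm).symm
      · rcases hm with rfl | ⟨rfl, rfl⟩
        · exact absurd hj hjm
        · have hjm' : ((m : ℕ) : ℕ∞) ≤ j := by exact_mod_cast not_lt.1 hjm
          exact Fin.ext ((hC.zero x j hjm').trans (hC'.zero y j hjm').symm)
    · exact h.color p hp j hj
  · intro u hu
    by_cases hall : ∀ i, u i ∈ S
    · exact h.edge u hall
    push Not at hall
    obtain ⟨i₀, hi₀⟩ := hall
    have hui₀ : u i₀ = (x, y) := (hu i₀).resolve_right hi₀
    -- If the new pair occurs once, a transposition moves it to the front, where `P` decides. If it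
    -- occurs twice, neither side is an edge.
    by_cases hrest : ∀ i, i ≠ i₀ → u i ∈ S
    · let σ : Equiv.Perm (Fin (r + 1)) := Equiv.swap 0 i₀
      let w : Fin r → M × M' := fun i => u (σ i.succ)
      have hw : ∀ i, w i ∈ S := fun i => hrest _ fun hσ => by
        have : i.succ = 0 := σ.injective (by simpa [σ] using hσ)
        exact Fin.succ_ne_zero _ this
      have h1 : (fun i => (u i).1) ∘ σ = Fin.cons x fun i => (w i).1 := by
        funext i
        refine Fin.cases ?_ (fun i => ?_) i <;> simp [w, σ, hui₀]
      have h2 : (fun i => (u i).2) ∘ σ = Fin.cons y fun i => (w i).2 := by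
        funext i
        refine Fin.cases ?_ (fun i => ?_) i <;> simp [w, σ, hui₀]
      rw [← hC.edge_comp_iff σ, ← hC'.edge_comp_iff σ, h1, h2, hye _ fun i => hSF _ (hw i)]
      constructor
      · exact fun he => ⟨w, hw, rfl, he⟩
      · rintro ⟨w', hw', hww, he⟩
        convert he using 3 with i
        exact (h.eq_iff _ (hw i) _ (hw' i)).2 (congrFun hww i)
    · push Not at hrest
      obtain ⟨i₁, hi₁, hi₁S⟩ := hrest
      have hui₁ : u i₁ = (x, y) := (hu i₁).resolve_right hi₁S
      refine iff_of_false (fun he => hi₁ ?_) (fun he => hi₁ ?_)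
      · exact hC.inj _ he (by simp [hui₀, hui₁])
      · exact hC'.inj _ he (by simp [hui₀, hui₁])

theorem IsGeneric.exists_agree_insert {N N' : ℕ∞} {l : ℕ} (hC : C.IsBase N)
    (hC' : C'.IsGeneric N') (hN : N = N' ∨ (l : ℕ∞) ≤ N ∧ (l : ℕ∞) ≤ N') {S : Set (M × M')}
    (hS : S.Finite) (h : Agree l C C' S) {n : ℕ} (hn : S.ncard ≤ n)
    (hl : H.HasJoins ⊤ l n) (x : M) : ∃ y, Agree l C C' (insert (x, y) S) := by
  by_cases hx : ∃ p ∈ S, p.1 = x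
  · obtain ⟨p, hp, rfl⟩ := hx
    exact ⟨p.2, by rwa [Set.insert_eq_of_mem hp]⟩
  · push Not at hx
    obtain ⟨y, -, hy⟩ := hC'.exists_agree_insert_avoiding hC hN hS h ∅ (by simpa using hn) hl hx
    exact ⟨y, hy⟩

theorem IsGeneric.exists_agree_superset {N N' : ℕ∞} {l : ℕ} (hC : C.IsBase N)
    (hC' : C'.IsGeneric N') (hN : N = N' ∨ (l : ℕ∞) ≤ N ∧ (l : ℕ∞) ≤ N') {S : Set (M × M')}
    (hS : S.Finite) (h : Agree l C C' S) {a n : ℕ} (hn : S.ncard + a ≤ n)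
    (hl : H.HasJoins ⊤ l n) (e : Fin a → M) :
    ∃ e' : Fin a → M', Agree l C C' (Set.range (fun i => (e i, e' i)) ∪ S) := by
  induction a with
  | zero => exact ⟨Fin.elim0, by simpa using h⟩
  | succ a ih =>
    obtain ⟨e', he'⟩ := ih (by omega) (fun i => e i.castSucc)
    have hfin : (Set.range fun i => (e (Fin.castSucc i), e' i)).Finite := Set.finite_range _
    have hcard : (Set.range fun i => (e (Fin.castSucc i), e' i)).ncard ≤ a := by
      rw [← Set.image_univ]
      exact (Set.ncard_image_le Set.finite_univ).trans (by simp)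
    obtain ⟨y, hy⟩ := hC'.exists_agree_insert hC hN (hfin.union hS) he'
      (n := n) ((Set.ncard_union_le _ _).trans (by omega)) hl (e (Fin.last a))
    refine ⟨Fin.snoc e' y, hy.mono le_rfl ?_⟩
    rintro p (⟨i, rfl⟩ | hp)
    · refine Fin.lastCases ?_ (fun i => ?_) i
      · simp
      · right; left; exact ⟨i, by simp⟩
    · exact Or.inr (Or.inr hp)

end Agree

end ColoredHypergraph

end HypergraphSeq

namespace HypergraphSeq

variable {r : ℕ} {H : HypergraphSeq r}

/-! ### Generic extensions -/

variable (H) in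
/-- The branches of the tree, normalized to be `0` at the levels from `N` on. -/
def Branch (N : ℕ∞) : Type :=
  {β : ∀ j, Fin (H.size j) // ∀ j : ℕ, N ≤ j → (β j : ℕ) = 0}

variable (H) in
/-- The vertex set of the free generic extension of a colored hypergraph on `M`: for all finite
sequences `x` of vertices there are new vertices of all colors, joined to any prescribed set of
`r`-tuples from `x`. -/
inductive GenericExt (N : ℕ∞) (M : Type w) : Type w
  | base (a : M) : GenericExt N M
  | new (β : H.Branch N) (n : ℕ) (x : Fin n → GenericExt N M) (P : Set (Fin r → Fin n)) :
      GenericExt N M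

namespace GenericExt

variable {N : ℕ∞} {M : Type w}

/-- A new vertex has larger rank than those it is built over. So it lies outside the set it extends,
and two new vertices cannot each be built over the other. -/
def rank : H.GenericExt N M → ℕ
  | base _ => 0
  | new _ _ x _ => (Finset.univ.sup fun i => (x i).rank) + 1

theorem rank_lt_rank_new (β : H.Branch N) (n : ℕ) (x : Fin n → H.GenericExt N M)
    (P : Set (Fin r → Fin n)) (i : Fin n) : (x i).rank < (new β n x P).rank :=
  Nat.lt_succ_of_le (Finset.le_sup (f := fun i => (x i).rank) (Finset.mem_univ i))

theorem base_injective : Function.Injective (base : M → H.GenericExt N M) :=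
  fun _ _ h => by cases h; rfl

/-- The free generic extension of a colored hypergraph. -/
def coloredHypergraph (N : ℕ∞) (C : H.ColoredHypergraph M) :
    H.ColoredHypergraph (H.GenericExt N M) where
  color
    | base a => C.color a
    | new β _ _ _ => β.1
  -- The vertices `new` are added for all data, consistent or not; these two clauses discard the
  -- inadmissible edges.
  edge z := Function.Injective z ∧
    (∀ j : ℕ, (j : ℕ∞) < N → (fun i => (match z i with
      | base a => C.color a
      | new β _ _ _ => β.1 : ∀ j, Fin (H.size j)) j) ∈ H.E j) ∧
    ((∃ x, z = base ∘ x ∧ C.edge x) ∨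
      ∃ (β : H.Branch N) (n : ℕ) (x : Fin n → H.GenericExt N M) (P : Set (Fin r → Fin n)),
        ∃ u ∈ P, ∃ σ : Equiv.Perm (Fin (r + 1)), z ∘ σ = Fin.cons (new β n x P) (x ∘ u))

variable {C : H.ColoredHypergraph M}

theorem edge_base_iff (hC : C.IsBase N) (x : Fin (r + 1) → M) :
    (coloredHypergraph N C).edge (base ∘ x) ↔ C.edge x := by
  constructor
  · rintro ⟨-, -, ⟨y, hy, he⟩ | ⟨β, n, y, P, u, -, σ, hz⟩⟩
    · rwa [base_injective.comp_left hy]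
    · have := congrFun hz 0
      simp at this
  · exact fun he => ⟨base_injective.comp (hC.inj x he), hC.compat x he, Or.inl ⟨x, rfl, he⟩⟩

/-- For consistent data the extra clauses in the definition of an edge hold automatically.
Conversely no other new vertex can have prescribed such an edge, by comparison of ranks. -/
theorem edge_new_iff {β : H.Branch N} {n : ℕ} {x : Fin n → H.GenericExt N M}
    {P : Set (Fin r → Fin n)} (hx : Function.Injective x)
    (hP : ∀ u ∈ P, ∀ σ : Equiv.Perm (Fin r), u ∘ σ ∈ P) (hP' : ∀ u ∈ P, Function.Injective u)
    (hPE : ∀ u ∈ P, ∀ j : ℕ, (j : ℕ∞) < N →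
      (Fin.cons (β.1 j) fun i => (coloredHypergraph N C).color (x (u i)) j :
        Fin (r + 1) → Fin (H.size j)) ∈ H.E j)
    (u : Fin r → Fin n) :
    (coloredHypergraph N C).edge (Fin.cons (new β n x P) (x ∘ u)) ↔ u ∈ P := by
  constructor
  · rintro ⟨hinj, -, ⟨y, hy, he⟩ | ⟨β', n', x', P', u', hu', σ, hz⟩⟩
    · have := congrFun hy 0
      simp at this
    · by_cases hσ : σ 0 = 0
      · have h0 := congrFun hz 0
        simp only [Function.comp_apply, hσ, Fin.cons_zero, new.injEq] at h0
        obtain ⟨rfl, rfl, h1, h2⟩ := h0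
        obtain rfl := eq_of_heq h1
        obtain rfl := eq_of_heq h2
        obtain ⟨τ, hτ⟩ := exists_perm_succ hσ
        have huτ : u ∘ τ = u' := funext fun i => hx (by
          simpa [hτ] using congrFun hz i.succ)
        have := hP u' hu' τ⁻¹
        rwa [← huτ, Function.comp_assoc, ← Equiv.Perm.coe_mul, mul_inv_cancel,
          Equiv.Perm.coe_one, Function.comp_id] at this
      -- Here two new vertices would each be built over the other, against the ranks.
      · obtain ⟨i, hi⟩ := Fin.exists_succ_eq.2 hσ
        have h0 := congrFun hz 0
        simp only [Function.comp_apply, ← hi, Fin.cons_zero, Fin.cons_succ] at h0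
        have hσ' : σ.symm 0 ≠ 0 := fun h => hσ ((Equiv.symm_apply_eq σ).1 h).symm
        obtain ⟨i', hi'⟩ := Fin.exists_succ_eq.2 hσ'
        have h1 := congrFun hz i'.succ
        simp only [Function.comp_apply, hi', Equiv.apply_symm_apply, Fin.cons_zero] at h1
        rw [← hi', Fin.cons_succ] at h1
        have l1 := rank_lt_rank_new β n x P (u i)
        have l2 := rank_lt_rank_new β' n' x' P' (u' i')
        rw [h0] at l1
        rw [Function.comp_apply] at h1
        rw [← h1] at l2
        omega
  · intro hu
    refine ⟨?_, fun j hj => ?_, Or.inr ⟨β, n, x, P, u, hu, 1, rfl⟩⟩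
    · rw [Fin.cons_injective_iff]
      refine ⟨?_, hx.comp (hP' u hu)⟩
      rintro ⟨i, hi⟩
      exact absurd (rank_lt_rank_new β n x P (u i)) (by simp only [Function.comp_apply] at hi; simp [hi])
    · convert hPE u hu j hj using 1
      funext i
      refine Fin.cases rfl (fun i => rfl) i

theorem isGeneric (hH : H.IsTemplate) (hC : C.IsBase N) :
    (coloredHypergraph N C).IsGeneric N where
  symm := by
    rintro σ z ⟨h1, h2, h3⟩
    refine ⟨h1.comp σ.injective, fun j hj => hH.symm j σ (h2 j hj), ?_⟩
    rcases h3 with ⟨x, rfl, he⟩ | ⟨β, n, x, P, u, hu, τ, hz⟩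
    · exact Or.inl ⟨x ∘ σ, rfl, hC.symm σ x he⟩
    · refine Or.inr ⟨β, n, x, P, u, hu, σ⁻¹ * τ, ?_⟩
      rw [← hz]
      funext i
      simp
  inj z hz := hz.1
  compat z hz := hz.2.1
  zero z j hj := by
    cases z with
    | base a => exact hC.zero a j hj
    | new β n x P => exact β.2 j hj
  extension := by
    classical
    intro F P l β hlN hjoins hP hP' hPE
    let x : Fin F.card → H.GenericExt N M := fun i => F.equivFin.symm i
    have hx : Function.Injective x := Subtype.val_injective.comp F.equivFin.symm.injective
    have hxF : ∀ y, y ∈ F ↔ ∃ i, x i = y := fun y =>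
      ⟨fun hy => ⟨F.equivFin ⟨y, hy⟩, by simp [x]⟩, by rintro ⟨i, rfl⟩; exact Subtype.prop _⟩
    let P' : Set (Fin r → Fin F.card) := {u | x ∘ u ∈ P}
    -- The color of the witness: `β` below `l`, a vertex joined to all colors of `F` from `l` to
    -- `N`, and `0` from `N` on.
    have key : ∀ j : ℕ, ∃ s : Fin (H.size j), (j < l → s = β j) ∧ (N ≤ j → (s : ℕ) = 0) ∧
        ((j : ℕ∞) < N → ∀ u ∈ P', (Fin.cons s fun i => (coloredHypergraph N C).color (x (u i)) j :
          Fin (r + 1) → Fin (H.size j)) ∈ H.E j) := by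
      intro j
      by_cases hjl : j < l
      · have hjN : (j : ℕ∞) < N := lt_of_lt_of_le (by exact_mod_cast hjl) hlN
        exact ⟨β j, fun _ => rfl, fun h => absurd hjN (not_lt.2 h),
          fun _ u hu => hPE _ hu (fun i => (hxF _).2 ⟨_, rfl⟩) j hjl⟩
      · by_cases hjN : (j : ℕ∞) < N
        · obtain ⟨s, hs⟩ := hjoins _ le_rfl j (not_lt.1 hjl) hjN
            (fun i => (coloredHypergraph N C).color (x i) j)
          exact ⟨s, fun h => absurd h hjl, fun h => absurd hjN (not_lt.2 h), fun _ u _ => hs u⟩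
        · exact ⟨⟨0, hH.size_pos j⟩, fun h => absurd h hjl, fun _ => rfl, fun h => absurd h hjN⟩
    choose γ hγ1 hγ2 hγ3 using key
    let y : H.GenericExt N M := new ⟨γ, hγ2⟩ F.card x P'
    refine ⟨y, fun hy => ?_, fun j hj => hγ1 j hj, fun u hu => ?_⟩
    · obtain ⟨i, hi⟩ := (hxF _).1 hy
      exact absurd (rank_lt_rank_new ⟨γ, hγ2⟩ F.card x P' i) (by rw [hi]; exact lt_irrefl _)
    · choose u' hu' using fun i => (hxF _).1 (hu i)
      obtain rfl : x ∘ u' = u := funext hu'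
      exact edge_new_iff hx (fun u hu σ => hP (x ∘ u) hu σ)
        (fun u hu => Function.Injective.of_comp (hP' _ hu)) (fun u hu j hj => hγ3 j hj u hu) u'

end GenericExt

end HypergraphSeq

namespace HypergraphSeq

open FirstOrder.Language

variable {r : ℕ} {H : HypergraphSeq r} {N : ℕ∞}

/-! ### Models as colored hypergraphs -/

section Realize

variable {M : Type*} [(H.language N).Structure M]

/-- The interpretation of the predicate `Q η`. -/
def QRel (η : H.Node N) (a : M) : Prop :=
  Structure.RelMap (L := H.language N) (Rel.Q η : H.Rel N 1) fun _ : Fin 1 => a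

variable (H N) in
/-- The interpretation of the relation `R`. -/
def RRel (x : Fin (r + 1) → M) : Prop :=
  Structure.RelMap (L := H.language N) (Rel.R : H.Rel N (r + 1)) x

theorem realize_predQ {η : H.Node N} {n : ℕ} {i : Fin n} {v : Empty → M} {xs : Fin n → M} :
    (predQ η i).Realize v xs ↔ QRel η (xs i) :=
  Iff.rfl

theorem realize_relR {n : ℕ} {s : Fin (r + 1) → Fin n} {v : Empty → M} {xs : Fin n → M} :
    (H.relR N s).Realize v xs ↔ H.RRel N (xs ∘ s) :=
  Iff.rfl

theorem realize_alls_iff {n : ℕ} {φ : (H.language N).BoundedFormula Empty n} :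
    M ⊨ φ.alls ↔ ∀ xs : Fin n → M, φ.Realize default xs :=
  BoundedFormula.realize_alls

theorem forall_fin_one {p : M → Prop} : (∀ xs : Fin 1 → M, p (xs 0)) ↔ ∀ a, p a :=
  ⟨fun h a => h fun _ => a, fun h _ => h _⟩

theorem models_baseTheory_iff : M ⊨ H.baseTheory N ↔
    (∀ (σ : Equiv.Perm (Fin (r + 1))) (x : Fin (r + 1) → M), H.RRel N x → H.RRel N (x ∘ σ)) ∧
    (∀ i j : Fin (r + 1), i ≠ j → ∀ x : Fin (r + 1) → M, x i = x j → ¬ H.RRel N x) ∧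
    (∀ a : M, QRel (H.root N) a) ∧
    (∀ η ν : H.Node N, η.1 <+: ν.1 → ∀ a : M, QRel ν a → QRel η a) ∧
    (∀ (η : H.Node N) (h : ((η.1.length + 1 : ℕ) : ℕ∞) ≤ N) (i j : Fin (H.size η.1.length)),
      i ≠ j → ∀ a : M, ¬ (QRel (η.child h i) a ∧ QRel (η.child h j) a)) ∧
    (∀ (η : H.Node N) (h : ((η.1.length + 1 : ℕ) : ℕ∞) ≤ N), ∀ a : M, QRel η a →
      ∃ i, QRel (η.child h i) a) ∧
    (∀ (η : Fin (r + 1) → H.Node N) (n : ℕ) (h : ∀ i, n < (η i).1.length),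
      (fun i => (η i).vertex n (h i)) ∉ H.E n → ∀ x : Fin (r + 1) → M,
        (∀ i, QRel (η i) (x i)) → ¬ H.RRel N x) := by
  rw [Theory.model_iff]
  constructor
  · intro h
    refine ⟨fun σ => ?_, fun i j hij => ?_, ?_, fun η ν hην => ?_, fun η hη i j hij => ?_,
      fun η hη => ?_, fun η n hn hE => ?_⟩
    · have := realize_alls_iff.1 (h (H.relR N id ⟹ H.relR N σ).alls (by
        iterate 6 left
        exact ⟨σ, rfl⟩))
      exact this
    · have := realize_alls_iff.1 (h ((Term.bdEqual (&i) (&j)) ⟹ ∼(H.relR N id)).alls (by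
        iterate 5 left
        right
        exact ⟨i, j, hij, rfl⟩))
      exact this
    · have := realize_alls_iff.1 (h (predQ (H.root N) (0 : Fin 1)).alls (by
        iterate 4 left
        right
        rfl))
      exact forall_fin_one.1 this
    · have := realize_alls_iff.1 (h (predQ ν (0 : Fin 1) ⟹ predQ η 0).alls (by
        iterate 3 left
        right
        exact ⟨η, ν, hην, rfl⟩))
      exact forall_fin_one (p := fun a => QRel ν a → QRel η a).1 this
    · have := realize_alls_iff.1 (h (∼(predQ (η.child hη i) (0 : Fin 1) ⊓ predQ (η.child hη j) 0)).alls (by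
        iterate 2 left
        right
        exact ⟨η, hη, i, j, hij, rfl⟩))
      simp only [BoundedFormula.realize_not, BoundedFormula.realize_inf, realize_predQ] at this
      exact forall_fin_one (p := fun a => ¬ (QRel (η.child hη i) a ∧ QRel (η.child hη j) a)).1 this
    · have := realize_alls_iff.1 (h (predQ η (0 : Fin 1) ⟹
          BoundedFormula.iSup fun i => predQ (η.child hη i) 0).alls (by
        left
        right
        exact ⟨η, hη, rfl⟩))
      simp only [BoundedFormula.realize_imp, BoundedFormula.realize_iSup, realize_predQ] at this
      exact forall_fin_one (p := fun a => QRel η a → ∃ i, QRel (η.child hη i) a).1 this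
    · have := realize_alls_iff.1 (h ((BoundedFormula.iInf fun i => predQ (η i) i) ⟹
          ∼(H.relR N id)).alls (by
        right
        exact ⟨η, n, hn, hE, rfl⟩))
      simp only [BoundedFormula.realize_imp, BoundedFormula.realize_iInf, realize_predQ,
        BoundedFormula.realize_not, realize_relR] at this
      exact this
  · rintro ⟨h1, h2, h3, h4, h5, h6, h7⟩ φ
      ((((((⟨σ, rfl⟩ | ⟨i, j, hij, rfl⟩) | rfl) | ⟨η, ν, hην, rfl⟩) | ⟨η, hη, i, j, hij, rfl⟩) |
        ⟨η, hη, rfl⟩) | ⟨η, n, hn, hE, rfl⟩) <;> rw [realize_alls_iff]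
    · exact h1 σ
    · exact h2 i j hij
    · exact fun xs => h3 _
    · exact fun xs => h4 η ν hην _
    · simp only [BoundedFormula.realize_not, BoundedFormula.realize_inf, realize_predQ]
      exact fun xs => h5 η hη i j hij _
    · simp only [BoundedFormula.realize_imp, BoundedFormula.realize_iSup, realize_predQ]
      exact fun xs => h6 η hη _
    · simp only [BoundedFormula.realize_imp, BoundedFormula.realize_iInf, realize_predQ,
        BoundedFormula.realize_not, realize_relR]
      exact h7 η n hn hE

end Realize

/-- The node of length `l` with prescribed vertices. -/
def Node.ofFn (l : ℕ) (hl : (l : ℕ∞) ≤ N) (β : ∀ j : Fin l, Fin (H.size j)) : H.Node N :=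
  ⟨List.ofFn fun j => (β j : ℕ), fun n hn => by simp, by simpa using hl⟩

namespace ColoredHypergraph

/-- The structure given by a colored hypergraph. -/
@[reducible] def str {M : Type*} (C : H.ColoredHypergraph M) (N : ℕ∞) :
    (H.language N).Structure M where
  funMap := fun f => Empty.elim f
  RelMap := fun {n} (s : H.Rel N n) => match n, s with
    | _, .R => fun x => C.edge x
    | _, .Q η => fun x => ∀ j (h : j < η.1.length), η.vertex j h = C.color (x 0) j

variable {M : Type*} {C : H.ColoredHypergraph M}

theorem QRel_str_iff {η : H.Node N} {a : M} :
    letI := C.str N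
    QRel η a ↔ ∀ j (h : j < η.1.length), η.vertex j h = C.color a j :=
  Iff.rfl

theorem RRel_str_iff {x : Fin (r + 1) → M} :
    letI := C.str N
    H.RRel N x ↔ C.edge x :=
  Iff.rfl

theorem QRel_ofFn_iff {l : ℕ} {hl : (l : ℕ∞) ≤ N} {β : ∀ j : Fin l, Fin (H.size j)} {a : M} :
    letI := C.str N
    QRel (Node.ofFn l hl β) a ↔ ∀ j : Fin l, C.color a j = β j := by
  rw [QRel_str_iff]
  constructor
  · intro h j
    rw [← h j (by simp [Node.ofFn])]
    exact Fin.ext (by simp [Node.ofFn, Node.vertex])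
  · intro h j hj
    have hj' : j < l := by simpa [Node.ofFn] using hj
    rw [h ⟨j, hj'⟩]
    exact Fin.ext (by simp [Node.ofFn, Node.vertex])

theorem vertex_child_last {η : H.Node N} (h : ((η.1.length + 1 : ℕ) : ℕ∞) ≤ N)
    (i : Fin (H.size η.1.length)) (h' : η.1.length < (η.child h i).1.length) :
    (η.child h i).vertex η.1.length h' = i :=
  Fin.ext (by simp [Node.child, Node.vertex])

theorem vertex_of_prefix {η ν : H.Node N} (h : η.1 <+: ν.1) (j : ℕ) (hj : j < η.1.length) :
    ν.vertex j (hj.trans_le h.length_le) = η.vertex j hj :=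
  Fin.ext (h.getElem hj).symm

theorem lt_of_node (η : H.Node N) {j : ℕ} (hj : j < η.1.length) : (j : ℕ∞) < N :=
  lt_of_lt_of_le (by exact_mod_cast hj) η.2.2

theorem IsBase.models (hC : C.IsBase N) :
    letI := C.str N
    M ⊨ H.baseTheory N := by
  let := C.str N
  rw [models_baseTheory_iff]
  refine ⟨hC.symm, fun i j hij x hx he => hij (hC.inj x he hx), fun a j hj => ?_,
    fun η ν h a hν j hj => ?_, ?_, ?_, ?_⟩
  · simp [root] at hj
  · rw [← hν j (hj.trans_le h.length_le), vertex_of_prefix h]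
  · rintro η h i j hij a ⟨hi, hj⟩
    have hlt : η.1.length < (η.child h i).1.length := by simp [Node.child]
    have h1 := hi _ hlt
    have h2 := hj η.1.length (by simp [Node.child])
    rw [vertex_child_last] at h1 h2
    exact hij (h1.trans h2.symm)
  · intro η h a ha
    refine ⟨C.color a η.1.length, fun j hj => ?_⟩
    rcases Nat.lt_succ_iff_lt_or_eq.1 (show j < η.1.length + 1 by simpa [Node.child] using hj)
      with hlt | rfl
    · rw [← ha j hlt]
      exact vertex_of_prefix (List.prefix_append _ _) j hlt
    · exact vertex_child_last _ _ _
  · intro η n hn hE x hx he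
    refine hE ?_
    convert hC.compat x he n (lt_of_node _ (hn 0)) using 1
    funext i
    exact hx i n (hn i)

/-- Climbing the tree by the covering axioms puts each point into a predicate of every length up to
`N`. At the first level where two such nodes differ, disjoint siblings would share the point. So the
nodes of a point form one branch, and this is its color. -/
theorem exists_isBase_of_models (hH : H.IsTemplate) [S : (H.language N).Structure M]
    (hM : M ⊨ H.baseTheory N) : ∃ C : H.ColoredHypergraph M, C.IsBase N ∧ S = C.str N := by
  obtain ⟨h1, h2, h3, h4, h5, h6, h7⟩ := models_baseTheory_iff.1 hM
  have hex : ∀ (a : M) (l : ℕ), (l : ℕ∞) ≤ N → ∃ η : H.Node N, η.1.length = l ∧ QRel η a := by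
    intro a l
    induction l with
    | zero => exact fun _ => ⟨H.root N, rfl, h3 a⟩
    | succ l ih =>
      intro hl
      obtain ⟨η, rfl, hη⟩ := ih (le_trans (by exact_mod_cast Nat.le_succ l) hl)
      obtain ⟨i, hi⟩ := h6 η hl a hη
      exact ⟨_, by simp [Node.child], hi⟩
  have huniq : ∀ (a : M) (η ν : H.Node N), QRel η a → QRel ν a →
      ∀ j (hj : j < η.1.length) (hj' : j < ν.1.length), η.vertex j hj = ν.vertex j hj' := by
    have take : ∀ (η : H.Node N) (j : ℕ), ∃ η' : H.Node N, η'.1 = η.1.take j := fun η j =>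
      ⟨⟨η.1.take j, fun n hn => by
        rw [List.getElem_take]
        exact η.2.1 n _, le_trans (by simp) η.2.2⟩, rfl⟩
    intro a η ν hη hν j
    induction j using Nat.strong_induction_on with
    | _ j ih =>
      intro hj hj'
      -- `κ` is the common initial segment of `η` and `ν`; different vertices at `j` would give two
      -- children of `κ` that both contain `a`.
      obtain ⟨κ, hκ⟩ := take η j
      have hκl : κ.1.length = j := by simp [hκ, hj.le]
      subst hκl
      have hl : ((κ.1.length + 1 : ℕ) : ℕ∞) ≤ N := le_trans (by exact_mod_cast hj) η.2.2
      have hκν : κ.1 = ν.1.take κ.1.length := by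
        refine List.ext_getElem (by simp [hj'.le]) fun n hn hn' => ?_
        rw [List.getElem_take]
        have := congrArg Fin.val (ih n hn (hn.trans hj) (hn.trans hj'))
        simp only [Node.vertex] at this
        rw [← this, List.getElem_of_eq hκ hn, List.getElem_take]
      have e1 : (κ.child hl (η.vertex _ hj)).1 <+: η.1 := by
        have : (κ.child hl (η.vertex _ hj)).1 = η.1.take (κ.1.length + 1) := by
          rw [List.take_succ_eq_append_getElem hj, ← hκ]
          rfl
        rw [this]
        exact List.take_prefix _ _
      have e2 : (κ.child hl (ν.vertex _ hj')).1 <+: ν.1 := by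
        have : (κ.child hl (ν.vertex _ hj')).1 = ν.1.take (κ.1.length + 1) := by
          rw [List.take_succ_eq_append_getElem hj', ← hκν]
          rfl
        rw [this]
        exact List.take_prefix _ _
      by_contra hne
      exact h5 κ hl _ _ hne a ⟨h4 _ _ e1 a hη, h4 _ _ e2 a hν⟩
  have hcol : ∀ (a : M) (j : ℕ), ∃ s : Fin (H.size j), (N ≤ j → (s : ℕ) = 0) ∧
      ∀ (η : H.Node N) (hj : j < η.1.length), QRel η a → η.vertex j hj = s := by
    intro a j
    by_cases hj : (j : ℕ∞) < N
    · obtain ⟨η, hη, ha⟩ := hex a (j + 1) (by exact_mod_cast Order.add_one_le_of_lt hj)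
      exact ⟨η.vertex j (by omega), fun h => absurd hj (not_lt.2 h),
        fun ν hν hνa => huniq a ν η hνa ha j _ _⟩
    · exact ⟨⟨0, hH.size_pos j⟩, fun _ => rfl, fun η hη _ => absurd (lt_of_node η hη) hj⟩
  choose col hcol0 hcol using hcol
  have hQ : ∀ (η : H.Node N) (a : M),
      QRel η a ↔ ∀ j (h : j < η.1.length), η.vertex j h = col a j := by
    intro η a
    refine ⟨fun h j hj => hcol a j η hj h, fun h => ?_⟩
    obtain ⟨ν, hν, hνa⟩ := hex a η.1.length η.2.2
    have : ν = η := Subtype.ext (List.ext_getElem hν fun n hn hn' =>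
      congrArg Fin.val ((hcol a n ν hn hνa).trans (h n hn').symm))
    exact this ▸ hνa
  refine ⟨⟨col, H.RRel N⟩, ⟨h1, fun x hx i j hij => ?_, fun x hx j hj => ?_, hcol0⟩, ?_⟩
  · by_contra hne
    exact h2 i j hne x hij hx
  · by_contra hE
    choose η hη hηx using fun i => hex (x i) (j + 1) (by exact_mod_cast Order.add_one_le_of_lt hj)
    refine h7 η j (fun i => by rw [hη]; omega) ?_ x hηx hx
    convert hE using 2
    funext i
    exact hcol _ _ _ _ (hηx i)
  · ext n s x
    · exact (s : Empty).elim
    · match n, s with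
      | _, .R => rfl
      | _, .Q η =>
        have hx : x = fun _ => x 0 := funext fun i => by rw [Subsingleton.elim i 0]
        refine Iff.trans ?_ (hQ η (x 0))
        rw [hx]
        rfl

end ColoredHypergraph

end HypergraphSeq

namespace HypergraphSeq

open FirstOrder.Language

variable {r : ℕ} {H : HypergraphSeq r} {N : ℕ∞}

/-! ### The extension axioms -/

section Axioms

variable {n l : ℕ} (hl : (l : ℕ∞) ≤ N) (β : ∀ j, Fin (H.size j)) (γ : Fin n → ∀ j, Fin (H.size j))
  (P : Set (Fin r → Fin n))

/-- The variables are distinct and have, up to level `l`, the colors `γ`. -/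
noncomputable def colorFormula : (H.language N).BoundedFormula Empty n :=
  (BoundedFormula.iInf fun i : Fin n => predQ (Node.ofFn l hl fun j => γ i j) i) ⊓
    BoundedFormula.iInf fun p : {p : Fin n × Fin n // p.1 ≠ p.2} =>
      ∼(Term.bdEqual (&p.1.1) (&p.1.2))

open Classical in
/-- The last variable differs from the others, has the color `β` up to level `l`, and is joined to
exactly those `r`-tuples of the others that belong to `P`. -/
noncomputable def joinFormula : (H.language N).BoundedFormula Empty (n + 1) :=
  predQ (Node.ofFn l hl fun j => β j) (Fin.last n) ⊓
    ((BoundedFormula.iInf fun i : Fin n => ∼(Term.bdEqual (&(Fin.last n)) (&i.castSucc))) ⊓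
      BoundedFormula.iInf fun u : Fin r → Fin n =>
        if u ∈ P then H.relR N (Fin.cons (Fin.last n) (Fin.castSucc ∘ u))
        else ∼(H.relR N (Fin.cons (Fin.last n) (Fin.castSucc ∘ u))))

/-- Only the colors below `l` are mentioned, which makes this a first-order sentence. Its shape,
universal over existential with quantifier-free parts, is what uniqueness of the model completion
uses. -/
noncomputable def extensionAxiom : (H.language N).Sentence :=
  (colorFormula hl γ ⟹ ∃' (joinFormula hl β P)).alls

/-- The consistency condition on the data of an extension axiom. -/
structure IsAdmissible (H : HypergraphSeq r) (N : ℕ∞) (n l : ℕ) (β : ∀ j, Fin (H.size j))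
    (γ : Fin n → ∀ j, Fin (H.size j)) (P : Set (Fin r → Fin n)) : Prop where
  joins : H.HasJoins N l n
  symm : ∀ u ∈ P, ∀ σ : Equiv.Perm (Fin r), u ∘ σ ∈ P
  inj : ∀ u ∈ P, Function.Injective u
  compat : ∀ u ∈ P, ∀ j < l,
    (Fin.cons (β j) fun i => γ (u i) j : Fin (r + 1) → Fin (H.size j)) ∈ H.E j

end Axioms

variable (H N) in
/-- The axioms of the model completion. -/
def genericTheory : (H.language N).Theory :=
  H.baseTheory N ∪ {φ | ∃ (n l : ℕ) (hl : (l : ℕ∞) ≤ N) (β : ∀ j, Fin (H.size j))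
    (γ : Fin n → ∀ j, Fin (H.size j)) (P : Set (Fin r → Fin n)),
    IsAdmissible H N n l β γ P ∧ φ = extensionAxiom hl β γ P}

open BoundedFormula in
theorem isQF_iInf {L : FirstOrder.Language.{u, v}} {α : Type*} {n : ℕ} {ι : Type*} [Finite ι]
    {f : ι → L.BoundedFormula α n} (h : ∀ i, IsQF (f i)) : IsQF (BoundedFormula.iInf f) := by
  have key : ∀ s : List (L.BoundedFormula α n), (∀ φ ∈ s, IsQF φ) → IsQF (s.foldr (· ⊓ ·) ⊤) := by
    intro s hs
    induction s with
    | nil => exact IsQF.top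
    | cons a s ih =>
      exact (hs a (by simp)).inf (ih fun φ hφ => hs φ (by simp [hφ]))
  refine key _ fun φ hφ => ?_
  obtain ⟨i, -, rfl⟩ := List.mem_map.1 hφ
  exact h i

open BoundedFormula in
theorem isQF_iSup {L : FirstOrder.Language.{u, v}} {α : Type*} {n : ℕ} {ι : Type*} [Finite ι]
    {f : ι → L.BoundedFormula α n} (h : ∀ i, IsQF (f i)) : IsQF (BoundedFormula.iSup f) := by
  have key : ∀ s : List (L.BoundedFormula α n), (∀ φ ∈ s, IsQF φ) → IsQF (s.foldr (· ⊔ ·) ⊥) := by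
    intro s hs
    induction s with
    | nil => exact isQF_bot
    | cons a s ih =>
      exact (hs a (by simp)).sup (ih fun φ hφ => hs φ (by simp [hφ]))
  refine key _ fun φ hφ => ?_
  obtain ⟨i, -, rfl⟩ := List.mem_map.1 hφ
  exact h i

theorem isQF_predQ (η : H.Node N) {n : ℕ} (i : Fin n) : (predQ η i).IsQF :=
  (BoundedFormula.IsAtomic.rel _ _).isQF

theorem isQF_relR {n : ℕ} (s : Fin (r + 1) → Fin n) : (H.relR N s).IsQF :=
  (BoundedFormula.IsAtomic.rel _ _).isQF

theorem isQF_colorFormula {n l : ℕ} (hl : (l : ℕ∞) ≤ N) (γ : Fin n → ∀ j, Fin (H.size j)) :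
    (colorFormula hl γ).IsQF :=
  (isQF_iInf fun _ => isQF_predQ _ _).inf
    (isQF_iInf fun _ => (BoundedFormula.IsAtomic.equal _ _).isQF.not)

theorem isQF_joinFormula {n l : ℕ} (hl : (l : ℕ∞) ≤ N) (β : ∀ j, Fin (H.size j))
    (P : Set (Fin r → Fin n)) : (joinFormula hl β P).IsQF := by
  refine (isQF_predQ _ _).inf ((isQF_iInf fun _ => (BoundedFormula.IsAtomic.equal _ _).isQF.not).inf
    (isQF_iInf fun u => ?_))
  split_ifs
  · exact isQF_relR _
  · exact (isQF_relR _).not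

/-! ### The axioms express the extension property. -/

namespace ColoredHypergraph

variable {M : Type*} {C : H.ColoredHypergraph M}

theorem realize_colorFormula {n l : ℕ} {hl : (l : ℕ∞) ≤ N} {γ : Fin n → ∀ j, Fin (H.size j)}
    {v : Empty → M} {x : Fin n → M} :
    letI := C.str N
    (colorFormula hl γ).Realize v x ↔
      Function.Injective x ∧ ∀ i, ∀ j < l, C.color (x i) j = γ i j := by
  simp only [colorFormula, BoundedFormula.realize_inf, BoundedFormula.realize_iInf, realize_predQ,
    BoundedFormula.realize_not, BoundedFormula.realize_bdEqual, QRel_ofFn_iff, Term.realize_var,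
    Sum.elim_inr, Function.comp_apply]
  rw [and_comm]
  refine and_congr ⟨fun h i j hij => ?_, fun h p hp => p.2 (h hp)⟩
    (forall_congr' fun i => ⟨fun h j hj => h ⟨j, hj⟩, fun h j => h j j.2⟩)
  by_contra hne
  exact h ⟨(i, j), hne⟩ hij

theorem realize_joinFormula {n l : ℕ} {hl : (l : ℕ∞) ≤ N} {β : ∀ j, Fin (H.size j)}
    {P : Set (Fin r → Fin n)} {v : Empty → M} {x : Fin n → M} {y : M} :
    letI := C.str N
    (joinFormula hl β P).Realize v (Fin.snoc x y : Fin (n + 1) → M) ↔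
      (∀ j < l, C.color y j = β j) ∧ (∀ i, y ≠ x i) ∧
        ∀ u : Fin r → Fin n, C.edge (Fin.cons y (x ∘ u)) ↔ u ∈ P := by
  classical
  let := C.str N
  simp only [joinFormula, BoundedFormula.realize_inf, BoundedFormula.realize_iInf, realize_predQ,
    BoundedFormula.realize_not, BoundedFormula.realize_bdEqual, QRel_ofFn_iff, Term.realize_var,
    Sum.elim_inr, Function.comp_apply, Fin.snoc_last, Fin.snoc_castSucc]
  refine and_congr ⟨fun h j hj => h ⟨j, hj⟩, fun h j => h j j.2⟩
    (and_congr Iff.rfl (forall_congr' fun u => ?_))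
  have hu : (Fin.snoc x y : Fin (n + 1) → M) ∘ (Fin.cons (Fin.last n) (Fin.castSucc ∘ u)) =
      Fin.cons y (x ∘ u) := by
    funext i
    refine Fin.cases ?_ (fun i => ?_) i <;> simp
  split_ifs with h
  · rw [realize_relR, hu, RRel_str_iff]
    simp [h]
  · rw [BoundedFormula.realize_not, realize_relR, hu, RRel_str_iff]
    simp [h]

theorem models_extensionAxiom_iff {n l : ℕ} {hl : (l : ℕ∞) ≤ N} {β : ∀ j, Fin (H.size j)}
    {γ : Fin n → ∀ j, Fin (H.size j)} {P : Set (Fin r → Fin n)} :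
    letI := C.str N
    M ⊨ extensionAxiom hl β γ P ↔
      ∀ x : Fin n → M, Function.Injective x → (∀ i, ∀ j < l, C.color (x i) j = γ i j) →
        ∃ y, (∀ j < l, C.color y j = β j) ∧ (∀ i, y ≠ x i) ∧
          ∀ u : Fin r → Fin n, C.edge (Fin.cons y (x ∘ u)) ↔ u ∈ P := by
  let := C.str N
  rw [extensionAxiom, realize_alls_iff]
  simp only [BoundedFormula.realize_imp, BoundedFormula.realize_ex, realize_colorFormula,
    realize_joinFormula, and_imp]

theorem IsGeneric.models (hC : C.IsGeneric N) :
    letI := C.str N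
    M ⊨ H.genericTheory N := by
  classical
  let := C.str N
  rw [genericTheory, Theory.model_union_iff]
  refine ⟨hC.toIsBase.models, Theory.model_iff _ |>.2 ?_⟩
  rintro _ ⟨n, l, hl, β, γ, P, hadm, rfl⟩
  rw [models_extensionAxiom_iff]
  intro x hx hγ
  have hcard : (Finset.univ.image x).card = n := by
    rw [Finset.card_image_of_injective _ hx, Finset.card_univ, Fintype.card_fin]
  obtain ⟨y, hyF, hyc, hye⟩ := hC.extension (Finset.univ.image x) {u | ∃ u' ∈ P, u = x ∘ u'} l β hl
    (by rw [hcard]; exact hadm.joins)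
    (by
      rintro _ ⟨u, hu, rfl⟩ σ
      exact ⟨u ∘ σ, hadm.symm u hu σ, rfl⟩)
    (by
      rintro _ ⟨u, hu, rfl⟩
      exact hx.comp (hadm.inj u hu))
    (by
      rintro _ ⟨u, hu, rfl⟩ - j hj
      convert hadm.compat u hu j hj using 3 with i
      exact hγ _ j hj)
  refine ⟨y, hyc, fun i hi => hyF (by simp [hi]), fun u => ?_⟩
  rw [hye _ fun i => by simp]
  constructor
  · rintro ⟨u', hu', h⟩
    rwa [hx.comp_left h]
  · exact fun hu => ⟨u, hu, rfl⟩

theorem IsBase.isGeneric_of_models (hC : C.IsBase N) :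
    letI := C.str N
    M ⊨ H.genericTheory N → C.IsGeneric N := by
  let := C.str N
  intro hM
  refine ⟨hC, ?_⟩
  intro F P l β hl hjoins hsymm hinj hcompat
  let x : Fin F.card → M := fun i => F.equivFin.symm i
  have hx : Function.Injective x := Subtype.val_injective.comp F.equivFin.symm.injective
  have hxF : ∀ y, y ∈ F ↔ ∃ i, x i = y := fun y =>
    ⟨fun hy => ⟨F.equivFin ⟨y, hy⟩, by simp [x]⟩, by rintro ⟨i, rfl⟩; exact Subtype.prop _⟩
  have hmem : extensionAxiom hl β (fun i => C.color (x i)) {u | x ∘ u ∈ P} ∈ H.genericTheory N :=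
    Or.inr ⟨_, l, hl, β, _, _, ⟨hjoins, fun u hu σ => hsymm (x ∘ u) hu σ,
      fun u hu => Function.Injective.of_comp (hinj _ hu),
      fun u hu j hj => hcompat _ hu (fun i => (hxF _).2 ⟨_, rfl⟩) j hj⟩, rfl⟩
  obtain ⟨y, hyc, hyx, hye⟩ := models_extensionAxiom_iff.1 (hM.realize_of_mem _ hmem) x hx
    fun _ _ _ => rfl
  refine ⟨y, fun hy => ?_, hyc, fun u hu => ?_⟩
  · obtain ⟨i, hi⟩ := (hxF y).1 hy
    exact hyx i hi.symm
  · choose u' hu' using fun i => (hxF _).1 (hu i)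
    obtain rfl : x ∘ u' = u := funext hu'
    exact hye u'

theorem exists_isGeneric_of_models (hH : H.IsTemplate) [S : (H.language N).Structure M]
    (hM : M ⊨ H.genericTheory N) : ∃ C : H.ColoredHypergraph M, C.IsGeneric N ∧ S = C.str N := by
  obtain ⟨C, hC, rfl⟩ := exists_isBase_of_models hH (hM.mono Set.subset_union_left)
  exact ⟨C, hC.isGeneric_of_models hM, rfl⟩

end ColoredHypergraph

end HypergraphSeq

namespace HypergraphSeq

open FirstOrder.Language

variable {r : ℕ} {H : HypergraphSeq r} {N : ℕ∞}

/-! ### Back and forth -/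

theorem exists_eq_var {V : Type*} (t : (H.language N).Term V) : ∃ a, t = Term.var a := by
  cases t with
  | var a => exact ⟨a, rfl⟩
  | func f ts => exact Empty.elim f

namespace ColoredHypergraph

/-- The level grows with the formula: a predicate `Q η` needs the levels below the length of `η`,
and a quantifier needs joins for as many vertices as there are free variables, so that the partial
isomorphism can be extended. The levels `N₁`, `N₂` of genericity are independent of the language and
may differ if both are at least `l`; the limit statement depends on this. -/
theorem exists_agree_level (hH : H.IsTemplate) {α : Type w} [Finite α] {n : ℕ}
    (φ : (H.language N).BoundedFormula α n) :
    ∃ l : ℕ, ∀ {N₁ N₂ : ℕ∞} {M₁ : Type u} {M₂ : Type v} {C₁ : H.ColoredHypergraph M₁}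
      {C₂ : H.ColoredHypergraph M₂} {c : α → M₁} {d : α → M₂} {x : Fin n → M₁} {y : Fin n → M₂},
      C₁.IsGeneric N₁ → C₂.IsGeneric N₂ → (N₁ = N₂ ∨ (l : ℕ∞) ≤ N₁ ∧ (l : ℕ∞) ≤ N₂) →
      Agree l C₁ C₂ (Set.range fun i => (Sum.elim c x i, Sum.elim d y i)) →
      (letI := C₁.str N; φ.Realize c x ↔ letI := C₂.str N; φ.Realize d y) := by
  induction φ with
  | falsum => exact ⟨0, fun _ _ _ _ => Iff.rfl⟩
  | equal t₁ t₂ =>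
    obtain ⟨a₁, rfl⟩ := exists_eq_var t₁
    obtain ⟨a₂, rfl⟩ := exists_eq_var t₂
    exact ⟨0, fun _ _ _ h => (agree_range_iff.1 h).1 a₁ a₂⟩
  | rel s ts =>
    choose u hu using fun i => exists_eq_var (ts i)
    obtain rfl : ts = fun i => Term.var (u i) := funext hu
    change H.Rel N _ at s
    cases s with
    | R => exact ⟨0, fun _ _ _ h => (agree_range_iff.1 h).2.2 u⟩
    | Q η =>
      refine ⟨η.1.length, fun _ _ _ h => ?_⟩
      refine forall_congr' fun j => forall_congr' fun hj => ?_
      have := (agree_range_iff.1 h).2.1 (u 0) j hj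
      simp only [Term.realize_var]
      rw [this]
  | imp φ ψ ihφ ihψ =>
    obtain ⟨l, hl⟩ := ihφ
    obtain ⟨l', hl'⟩ := ihψ
    refine ⟨max l l', fun h₁ h₂ hN h => ?_⟩
    have e1 : ((l : ℕ) : ℕ∞) ≤ (max l l' : ℕ) := by exact_mod_cast le_max_left l l'
    have e2 : ((l' : ℕ) : ℕ∞) ≤ (max l l' : ℕ) := by exact_mod_cast le_max_right l l'
    exact imp_congr
      (hl h₁ h₂ (hN.imp_right fun h => ⟨e1.trans h.1, e1.trans h.2⟩)
        (h.mono (le_max_left _ _) subset_rfl))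
      (hl' h₁ h₂ (hN.imp_right fun h => ⟨e2.trans h.1, e2.trans h.2⟩)
        (h.mono (le_max_right _ _) subset_rfl))
  | @all n φ ih =>
    obtain ⟨l, hl⟩ := ih
    obtain ⟨l', hl'⟩ := hH.exists_hasJoins (Nat.card (α ⊕ Fin n))
    have e1 : ((l : ℕ) : ℕ∞) ≤ (max l l' : ℕ) := by exact_mod_cast le_max_left l l'
    refine ⟨max l l', fun {N₁ N₂ M₁ M₂ C₁ C₂ c d x y} h₁ h₂ hN h => ?_⟩
    have hjoins := hl'.mono le_rfl (le_max_right l l') le_rfl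
    have step : ∀ (a : M₁) (b : M₂), Agree (max l l') C₁ C₂
        (insert (a, b) (Set.range fun i => (Sum.elim c x i, Sum.elim d y i))) →
        (letI := C₁.str N; φ.Realize c (Fin.snoc x a : Fin (n + 1) → M₁) ↔
          letI := C₂.str N; φ.Realize d (Fin.snoc y b : Fin (n + 1) → M₂)) := by
      intro a b hab
      refine hl h₁ h₂ (hN.imp_right fun h => ⟨e1.trans h.1, e1.trans h.2⟩)
        (hab.mono (le_max_left _ _) ?_)
      rintro _ ⟨i | i, rfl⟩
      · exact Or.inr ⟨Sum.inl i, rfl⟩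
      · refine Fin.lastCases (Or.inl ?_) (fun i => Or.inr ⟨Sum.inr i, ?_⟩) i <;> simp
    have hncard : ∀ {X : Type (max u v)} (f : α ⊕ Fin n → X),
        (Set.range f).ncard ≤ Nat.card (α ⊕ Fin n) := by
      intro X f
      rw [← Set.image_univ, ← Set.ncard_univ]
      exact Set.ncard_image_le Set.finite_univ
    constructor
    · intro hφ b
      obtain ⟨a, ha⟩ := h₁.exists_agree_insert h₂.toIsBase (hN.imp Eq.symm And.symm)
        (Set.finite_range fun i => (Sum.elim d y i, Sum.elim c x i))
        (h.symm.mono le_rfl (by rintro _ ⟨i, rfl⟩; exact ⟨i, rfl⟩)) (hncard _) hjoins b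
      refine (step a b (ha.symm.mono le_rfl ?_)).1 (hφ a)
      rintro p (rfl | ⟨i, rfl⟩)
      · exact Or.inl rfl
      · exact Or.inr ⟨i, rfl⟩
    · intro hφ a
      obtain ⟨b, hb⟩ := h₂.exists_agree_insert h₁.toIsBase hN
        (Set.finite_range fun i => (Sum.elim c x i, Sum.elim d y i)) h (hncard _) hjoins a
      exact (step a b hb).2 (hφ b)

theorem exists_agree_level_formula (hH : H.IsTemplate) {α : Type w} [Finite α]
    (φ : (H.language N).Formula α) :
    ∃ l : ℕ, ∀ {N₁ N₂ : ℕ∞} {M₁ : Type u} {M₂ : Type v} {C₁ : H.ColoredHypergraph M₁}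
      {C₂ : H.ColoredHypergraph M₂} {c : α → M₁} {d : α → M₂},
      C₁.IsGeneric N₁ → C₂.IsGeneric N₂ → (N₁ = N₂ ∨ (l : ℕ∞) ≤ N₁ ∧ (l : ℕ∞) ≤ N₂) →
      Agree l C₁ C₂ (Set.range fun i => (c i, d i)) →
      (letI := C₁.str N; φ.Realize c ↔ letI := C₂.str N; φ.Realize d) := by
  obtain ⟨l, hl⟩ := exists_agree_level hH φ
  refine ⟨l, fun h₁ h₂ hN h => hl h₁ h₂ hN (h.mono le_rfl ?_)⟩
  rintro _ ⟨i | i, rfl⟩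
  · exact ⟨i, rfl⟩
  · exact i.elim0

/-- Only finitely many variables occur in `φ`, so the finite case applies after restriction to them.
-/
theorem realize_iff_of_agree (hH : H.IsTemplate) {α : Type w} (φ : (H.language N).Formula α)
    {N' : ℕ∞} {M₁ : Type u} {M₂ : Type v} {C₁ : H.ColoredHypergraph M₁}
    {C₂ : H.ColoredHypergraph M₂} (h₁ : C₁.IsGeneric N') (h₂ : C₂.IsGeneric N') {c : α → M₁}
    {d : α → M₂} (h : ∀ l, Agree l C₁ C₂ (Set.range fun i => (c i, d i))) :
    (letI := C₁.str N; φ.Realize c ↔ letI := C₂.str N; φ.Realize d) := by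
  classical
  obtain ⟨l, hl⟩ := exists_agree_level_formula hH
    (BoundedFormula.restrictFreeVar φ (id : φ.freeVarFinset → _) : (H.language N).Formula _)
  have key := hl (c := fun i => c i) (d := fun i => d i) h₁ h₂ (Or.inl rfl) ((h l).mono le_rfl (by
    rintro _ ⟨i, rfl⟩
    exact ⟨i, rfl⟩))
  let := C₁.str N
  let := C₂.str N
  have e₁ := BoundedFormula.realize_restrictFreeVar (φ := φ) (f := id) (v := fun i => c i)
    (xs := (default : Fin 0 → M₁)) c fun _ => rfl
  have e₂ := BoundedFormula.realize_restrictFreeVar (φ := φ) (f := id) (v := fun i => d i)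
    (xs := (default : Fin 0 → M₂)) d fun _ => rfl
  exact e₁.symm.trans (key.trans e₂)

/-- Tuples that satisfy the same quantifier-free formulas agree. -/
theorem agree_of_realize_qf {V : Type w} {M₁ : Type u} {M₂ : Type v} {C₁ : H.ColoredHypergraph M₁}
    {C₂ : H.ColoredHypergraph M₂} (h₁ : C₁.IsBase N) (h₂ : C₂.IsBase N) {c : V → M₁}
    {d : V → M₂} (h : ∀ φ : (H.language N).Formula V, BoundedFormula.IsQF φ →
      (letI := C₁.str N; φ.Realize c → letI := C₂.str N; φ.Realize d)) (l : ℕ) :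
    Agree l C₁ C₂ (Set.range fun i => (c i, d i)) := by
  have h' : ∀ φ : (H.language N).Formula V, BoundedFormula.IsQF φ →
      (letI := C₁.str N; φ.Realize c ↔ letI := C₂.str N; φ.Realize d) := by
    intro φ hφ
    refine ⟨h φ hφ, fun hd => ?_⟩
    by_contra hc
    exact h φ.not hφ.not hc hd
  rw [agree_range_iff]
  refine ⟨fun i j => ?_, fun i j _ => ?_, fun u => ?_⟩
  · exact h' (Term.equal (Term.var i) (Term.var j)) (BoundedFormula.IsAtomic.equal _ _).isQF
  · by_cases hj : (j : ℕ∞) < N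
    · have hj' : ((j + 1 : ℕ) : ℕ∞) ≤ N := by exact_mod_cast Order.add_one_le_of_lt hj
      have := (h' (Relations.formula (L := H.language N) (Rel.Q (Node.ofFn (j + 1) hj'
        fun j => C₁.color (c i) j) : H.Rel N 1) fun _ => Term.var i)
        (BoundedFormula.IsAtomic.rel _ _).isQF).1
      have h2 := QRel_ofFn_iff.1 (this (QRel_ofFn_iff.2 fun _ => rfl)) ⟨j, Nat.lt_succ_self j⟩
      exact h2.symm
    · exact Fin.ext ((h₁.zero _ j (not_lt.1 hj)).trans (h₂.zero _ j (not_lt.1 hj)).symm)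
  · exact h' (Relations.formula (L := H.language N) (Rel.R : H.Rel N (r + 1))
      fun i => Term.var (u i)) (BoundedFormula.IsAtomic.rel _ _).isQF

end ColoredHypergraph

end HypergraphSeq

/-! ### Model completions -/

namespace FirstOrder.Language

variable {L : FirstOrder.Language.{u, v}}

theorem BoundedFormula.IsQF.mapTermRel {L' : FirstOrder.Language} {α β : Type*} {n : ℕ}
    {φ : L.BoundedFormula α n} (h : φ.IsQF)
    (ft : ∀ n, L.Term (α ⊕ (Fin n)) → L'.Term (β ⊕ (Fin n)))
    (fr : ∀ n, L.Relations n → L'.Relations n) :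
    (φ.mapTermRel (g := id) ft fr fun _ => id).IsQF := by
  induction h with
  | falsum => exact .falsum
  | of_isAtomic h =>
    cases h with
    | equal => exact (IsAtomic.equal _ _).isQF
    | rel => exact (IsAtomic.rel _ _).isQF
  | imp _ _ ih₁ ih₂ => exact ih₁.imp ih₂

theorem isQF_equivSentence {α : Type*} {φ : L.Formula α} (h : BoundedFormula.IsQF φ) :
    BoundedFormula.IsQF (Formula.equivSentence φ) :=
  (h.mapTermRel _ _).mapTermRel _ _

theorem isQF_equivSentence_symm {α : Type*} {φ : L[[α]].Sentence} (h : BoundedFormula.IsQF φ) :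
    BoundedFormula.IsQF (Formula.equivSentence.symm φ) :=
  (h.mapTermRel _ _).mapTermRel _ _

/-! ### Models of the diagram correspond to embeddings. -/

section Diagram

variable {M : Type*} [L.Structure M] {K : Type*} [L.Structure K]

theorem realize_con_of_models_qfDiagram [L[[M]].Structure K]
    [(L.lhomWithConstants M).IsExpansionOn K] (hK : K ⊨ L.qfDiagram M) {φ : L.Formula M}
    (hφ : BoundedFormula.IsQF φ) (h : φ.Realize (id : M → M)) :
    φ.Realize fun a => (L.con a : K) := by
  rw [← Formula.realize_equivSentence]
  refine hK.realize_of_mem _ ⟨isQF_equivSentence hφ, ?_⟩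
  rw [Formula.realize_equivSentence]
  exact h

/-- The canonical embedding into a model of the diagram. -/
def embeddingOfModelsQFDiagram [L[[M]].Structure K]
    [(L.lhomWithConstants M).IsExpansionOn K] (hK : K ⊨ L.qfDiagram M) : M ↪[L] K where
  toFun a := (L.con a : K)
  inj' := by
    intro a b hab
    by_contra hne
    exact realize_con_of_models_qfDiagram hK
      (φ := ∼(Term.equal (Term.var a) (Term.var b))) (BoundedFormula.IsAtomic.equal _ _).isQF.not
      hne hab
  map_fun' := by
    intro n f x
    exact (realize_con_of_models_qfDiagram hK
      (φ := Term.equal (Term.func f fun i => Term.var (x i)) (Term.var (Structure.funMap f x)))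
      (BoundedFormula.IsAtomic.equal _ _).isQF rfl).symm
  map_rel' := by
    intro n s x
    have e1 := realize_con_of_models_qfDiagram hK (φ := Relations.formula s fun i => Term.var (x i))
      (BoundedFormula.IsAtomic.rel _ _).isQF
    have e2 := realize_con_of_models_qfDiagram hK
      (φ := ∼(Relations.formula s fun i => Term.var (x i)))
      (BoundedFormula.IsAtomic.rel _ _).isQF.not
    refine ⟨fun h => ?_, e1⟩
    by_contra hne
    exact e2 hne h

theorem models_qfDiagram_of_embedding (f : M ↪[L] K) :
    letI := constantsOn.structure (f : M → K)
    K ⊨ L.qfDiagram M := by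
  let _ := constantsOn.structure (f : M → K)
  rw [Theory.model_iff]
  rintro φ ⟨hφ, hM⟩
  rw [← Formula.realize_equivSentence_symm_con] at hM ⊢
  have := (isQF_equivSentence_symm hφ).realize_embedding f
    (v := fun a => (L.con a : M)) (xs := default) |>.2 hM
  rw [Subsingleton.elim (f ∘ default) default] at this
  exact this

end Diagram

theorem onTheory_union_qfDiagram_models {T : L.Theory} {M : Type*} [L.Structure M] {K : Type*}
    [L.Structure K] (f : M ↪[L] K) (hK : K ⊨ T) :
    letI := constantsOn.structure (f : M → K)
    K ⊨ (L.lhomWithConstants M).onTheory T ∪ L.qfDiagram M := by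
  let _ := constantsOn.structure (f : M → K)
  exact Theory.model_union_iff.2
    ⟨(LHom.onTheory_model _ T).2 hK, models_qfDiagram_of_embedding f⟩

namespace IsModelCompletion

theorem models_base {T₀ T : L.Theory} (hT : IsModelCompletion.{u, v, w} T₀ T) {K : Type*}
    [L.Structure K] [Nonempty K] (hK : K ⊨ T) : K ⊨ T₀ :=
  (Theory.model_iff _).2 fun φ hφ => (hT.1 φ hφ).realize_sentence K

variable {L : FirstOrder.Language.{0, 0}} {T₀ T : L.Theory}

theorem exists_embedding (hT : IsModelCompletion.{0, 0, w} T₀ T) {M : Type w} [L.Structure M]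
    [Nonempty M] (hM : M ⊨ T₀) :
    ∃ (K : Type w) (_ : L.Structure K) (_ : Nonempty K), K ⊨ T ∧ Nonempty (M ↪[L] K) := by
  have hcomp : ((L.lhomWithConstants M).onTheory T ∪ L.qfDiagram M).IsComplete :=
    hT.2 (Theory.ModelType.of T₀ M)
  obtain ⟨K⟩ := hcomp.1
  have hK := Theory.model_union_iff.1 K.is_model
  let _ : L.Structure K := (L.lhomWithConstants M).reduct K
  exact ⟨K, inferInstance, inferInstance, (LHom.onTheory_model _ T).1 hK.1,
    ⟨embeddingOfModelsQFDiagram hK.2⟩⟩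

/-- Naming the elements of `K` by the identity in `K` and by `f` in `K'` gives two models of the
complete theory `T ∪ Diag(K)`. Hence `f` is elementary. -/
theorem realize_comp_iff (hT : IsModelCompletion.{0, 0, w} T₀ T) {K K' : Type w} [L.Structure K]
    [L.Structure K'] [Nonempty K] (hK : K ⊨ T) (hK' : K' ⊨ T) (f : K ↪[L] K') {α : Type*}
    (φ : L.Formula α) (x : α → K) : φ.Realize (f ∘ x) ↔ φ.Realize x := by
  have hK₀ : K ⊨ T₀ := hT.models_base hK
  have : Nonempty K' := ⟨f (Classical.arbitrary K)⟩
  have hcomp : ((L.lhomWithConstants K).onTheory T ∪ L.qfDiagram K).IsComplete :=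
    hT.2 (Theory.ModelType.of T₀ K)
  let ψ : L.Formula K := φ.relabel x
  have h1 : K ⊨ Formula.equivSentence ψ ↔
      ((L.lhomWithConstants K).onTheory T ∪ L.qfDiagram K) ⊨ᵇ Formula.equivSentence ψ := by
    have : K ⊨ (L.lhomWithConstants K).onTheory T ∪ L.qfDiagram K :=
      onTheory_union_qfDiagram_models (Embedding.refl L K) hK
    exact hcomp.realize_sentence_iff _ K
  have h2 : φ.Realize (f ∘ x) ↔
      ((L.lhomWithConstants K).onTheory T ∪ L.qfDiagram K) ⊨ᵇ Formula.equivSentence ψ := by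
    let _ := constantsOn.structure (f : K → K')
    have := onTheory_union_qfDiagram_models f hK'
    refine Iff.trans ?_ (hcomp.realize_sentence_iff _ K')
    rw [Formula.realize_equivSentence, Formula.realize_relabel]
    rfl
  rw [h2, ← h1, Formula.realize_equivSentence, Formula.realize_relabel]
  rfl

/-- Models of a model completion are existentially closed, for one quantifier. -/
theorem models_of_embedding (hT : IsModelCompletion.{0, 0, w} T₀ T) {K G : Type w} [L.Structure K]
    [L.Structure G] [Nonempty K] (hK : K ⊨ T) (hG : G ⊨ T₀) (f : K ↪[L] G) {n : ℕ}
    {θ : L.BoundedFormula Empty n} {χ : L.BoundedFormula Empty (n + 1)} (hθ : θ.IsQF)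
    (hχ : χ.IsQF) (h : G ⊨ (θ ⟹ ∃' χ).alls) : K ⊨ (θ ⟹ ∃' χ).alls := by
  have : Nonempty G := ⟨f (Classical.arbitrary K)⟩
  -- `G` lies between the models `K` and `K'` of `T`. A witness found in `G` persists to `K'`, and
  -- the elementary map from `K` to `K'` reflects its existence.
  obtain ⟨K', _, _, hK', ⟨g⟩⟩ := hT.exists_embedding hG
  refine BoundedFormula.realize_alls.2 fun x hx => ?_
  have h' := BoundedFormula.realize_alls.1 h (f ∘ x)
  rw [BoundedFormula.realize_imp, BoundedFormula.realize_ex] at h'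
  obtain ⟨y, hy⟩ := h' (by
    have := (hθ.realize_embedding f (v := default) (xs := x)).2 hx
    rwa [Subsingleton.elim (f ∘ default) default] at this)
  have h2 : (∃' χ).Realize (g.comp f ∘ default) (g.comp f ∘ x) := by
    rw [BoundedFormula.realize_ex]
    refine ⟨g y, ?_⟩
    have := (hχ.realize_embedding g (v := default) (xs := Fin.snoc (f ∘ x) y)).2 hy
    rw [Fin.comp_snoc] at this
    rwa [Subsingleton.elim (g.comp f ∘ default) (g ∘ default)]
  exact (BoundedFormula.realize_toFormula _ (Sum.elim default x)).1
    ((hT.realize_comp_iff hK hK' (g.comp f) (∃' χ).toFormula (Sum.elim default x)).1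
      ((BoundedFormula.realize_toFormula _ _).2 h2))

/-- Consequence is tested on models in `Type`; lifting them shows that models in `Type w` suffice.
-/
theorem modelsBoundedFormula_of_forall {φ : L.Sentence}
    (h : ∀ (K : Type w) [L.Structure K] [Nonempty K], K ⊨ T → K ⊨ φ) : T ⊨ᵇ φ := by
  rw [Theory.models_sentence_iff]
  intro M
  have h' := h (Theory.ModelType.ulift.{0, 0, 0, w} M) (Theory.ModelType.is_model _)
  let _ : L.Structure (ULift.{w, 0} M) := Equiv.ulift.{w, 0}.symm.inducedStructure
  exact (StrongHomClass.realize_sentence (Equiv.ulift.{w, 0}.symm.inducedStructureEquiv) φ).2 h'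

end IsModelCompletion

end FirstOrder.Language

namespace HypergraphSeq

open FirstOrder.Language

variable {r : ℕ} {H : HypergraphSeq r} {N : ℕ∞}

/-! ### The model completion, its uniqueness and completeness -/

variable (H) in
/-- The colored hypergraph without vertices. -/
def emptyHypergraph : H.ColoredHypergraph PEmpty.{w + 1} := ⟨PEmpty.elim, fun _ => False⟩

theorem isBase_emptyHypergraph : (emptyHypergraph.{w} H).IsBase N where
  symm := fun _ _ h => h
  inj := fun _ h => h.elim
  compat := fun _ h => h.elim
  zero := fun x => x.elim

theorem GenericExt.nonempty (hH : H.IsTemplate) (M : Type w) : Nonempty (H.GenericExt N M) :=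
  ⟨.new ⟨fun j => ⟨0, hH.size_pos j⟩, fun _ _ => rfl⟩ 0 Fin.elim0 ∅⟩

variable (N) in
theorem exists_isGeneric (hH : H.IsTemplate) :
    ∃ (M : Type w) (_ : Nonempty M) (C : H.ColoredHypergraph M), C.IsGeneric N :=
  ⟨_, GenericExt.nonempty hH PEmpty, _, GenericExt.isGeneric hH isBase_emptyHypergraph⟩

open ColoredHypergraph

/-- The embedding of a colored hypergraph into its free generic extension. -/
def GenericExt.embedding {M : Type w} {C : H.ColoredHypergraph M} (hC : C.IsBase N) :
    letI := C.str N
    letI := (GenericExt.coloredHypergraph N C).str N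
    M ↪[H.language N] H.GenericExt N M :=
  letI := C.str N
  letI := (GenericExt.coloredHypergraph N C).str N
  { toFun := .base
    inj' := GenericExt.base_injective
    map_fun' := fun f => Empty.elim f
    map_rel' := fun {n} (s : H.Rel N n) => match n, s with
      | _, .R => fun x => GenericExt.edge_base_iff hC x
      | _, .Q _ => fun _ => Iff.rfl }

theorem realize_sentence_iff (hH : H.IsTemplate) (φ : (H.language N).Sentence) {N' : ℕ∞}
    {M₁ : Type u} {M₂ : Type v} {C₁ : H.ColoredHypergraph M₁}
    {C₂ : H.ColoredHypergraph M₂} (h₁ : C₁.IsGeneric N') (h₂ : C₂.IsGeneric N') :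
    (letI := C₁.str N; M₁ ⊨ φ) ↔ (letI := C₂.str N; M₂ ⊨ φ) :=
  realize_iff_of_agree hH φ h₁ h₂ fun _ => ⟨by rintro _ ⟨i, -⟩; exact i.elim,
    by rintro _ ⟨i, -⟩; exact i.elim, fun u hu => (hu 0).choose.elim⟩

theorem isComplete_genericTheory (hH : H.IsTemplate) : (H.genericTheory N).IsComplete := by
  rw [Theory.IsComplete.isComplete_iff_models_elementarily_equivalent]
  constructor
  · obtain ⟨M, _, C, hC⟩ := exists_isGeneric.{0} N hH
    let := C.str N
    exact ⟨hC.models.bundled⟩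
  · intro M₁ M₂
    obtain ⟨C₁, h₁, e₁⟩ := exists_isGeneric_of_models hH M₁.is_model
    obtain ⟨C₂, h₂, e₂⟩ := exists_isGeneric_of_models hH M₂.is_model
    rw [elementarilyEquivalent_iff]
    intro φ
    rw [e₁, e₂]
    exact realize_sentence_iff hH φ h₁ h₂

theorem agree_con_of_models_qfDiagram {M : Type u}
    [S : (H.language N).Structure M]
    {C : H.ColoredHypergraph M} (hC : C.IsBase N) (hS : S = C.str N) {K : Type v}
    [SK : (H.language N).Structure K] [(H.language N)[[M]].Structure K]
    [((H.language N).lhomWithConstants M).IsExpansionOn K] (hK : K ⊨ (H.language N).qfDiagram M)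
    {CK : H.ColoredHypergraph K} (hCK : CK.IsBase N) (hSK : SK = CK.str N) (l : ℕ) :
    Agree l C CK (Set.range fun a : M => (a, ((H.language N).con a : K))) := by
  subst hS hSK
  let := C.str N
  let := CK.str N
  exact agree_of_realize_qf hC hCK (c := id)
    (fun φ hφ h => realize_con_of_models_qfDiagram hK hφ h) l

/-- Consistency comes from the free generic extension of `M`. For completeness, the two copies of
`M` in two models of the diagram correspond under a partial isomorphism that agrees at all levels.
-/
theorem isModelCompletion_genericTheory (hH : H.IsTemplate) :
    IsModelCompletion.{0, 0, w} (H.baseTheory N) (H.genericTheory N) := by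
  refine ⟨fun φ hφ => Theory.models_sentence_of_mem (Or.inl hφ), ?_⟩
  rintro ⟨M⟩
  obtain ⟨C, hC, rfl⟩ := exists_isBase_of_models hH ‹_›
  rw [Theory.IsComplete.isComplete_iff_models_elementarily_equivalent]
  constructor
  · let := C.str N
    let := (GenericExt.coloredHypergraph N C).str N
    let f := GenericExt.embedding hC
    have hmod := onTheory_union_qfDiagram_models f (GenericExt.isGeneric hH hC).models
    let := constantsOn.structure f
    have := GenericExt.nonempty (N := N) hH M
    exact ⟨hmod.bundled⟩
  · intro K₁ K₂
    let := C.str N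
    let i₁ : (H.language N).Structure K₁ := ((H.language N).lhomWithConstants M).reduct K₁
    let i₂ : (H.language N).Structure K₂ := ((H.language N).lhomWithConstants M).reduct K₂
    have m₁ := Theory.model_union_iff.1 K₁.is_model
    have m₂ := Theory.model_union_iff.1 K₂.is_model
    obtain ⟨C₁, h₁, e₁⟩ := exists_isGeneric_of_models hH ((LHom.onTheory_model _ _).1 m₁.1)
    obtain ⟨C₂, h₂, e₂⟩ := exists_isGeneric_of_models hH ((LHom.onTheory_model _ _).1 m₂.1)
    have a₁ := agree_con_of_models_qfDiagram hC rfl m₁.2 h₁.toIsBase e₁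
    have a₂ := agree_con_of_models_qfDiagram hC rfl m₂.2 h₂.toIsBase e₂
    rw [elementarilyEquivalent_iff]
    intro φ
    rw [← Formula.realize_equivSentence_symm_con, ← Formula.realize_equivSentence_symm_con, e₁, e₂]
    refine realize_iff_of_agree hH _ h₁ h₂ fun l => ?_
    refine Agree.trans_range (d := id) ?_ (a₂ l)
    refine (a₁ l).symm.mono le_rfl ?_
    rintro _ ⟨a, rfl⟩
    exact ⟨a, rfl⟩

theorem models_genericTheory_of_isModelCompletion (hH : H.IsTemplate) {T : (H.language N).Theory}
    (hT : IsModelCompletion.{0, 0, w} (H.baseTheory N) T) {K : Type w} [(H.language N).Structure K]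
    [Nonempty K] (hK : K ⊨ T) : K ⊨ H.genericTheory N := by
  have hK₀ := hT.models_base hK
  obtain ⟨C, hC, rfl⟩ := exists_isBase_of_models hH hK₀
  let := C.str N
  let := (GenericExt.coloredHypergraph N C).str N
  have hG := GenericExt.isGeneric hH hC
  refine Theory.model_union_iff.2 ⟨hK₀, (Theory.model_iff _).2 ?_⟩
  rintro _ ⟨n, l, hl, β, γ, P, hadm, rfl⟩
  exact hT.models_of_embedding hK hG.toIsBase.models (GenericExt.embedding hC)
    (isQF_colorFormula _ _) (isQF_joinFormula _ _ _)
    (hG.models.realize_of_mem _ (Or.inr ⟨n, l, hl, β, γ, P, hadm, rfl⟩))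

/-- `T` is consistent and its models satisfy `genericTheory`, which is already complete. -/
theorem theoryEquiv_of_isModelCompletion (hH : H.IsTemplate) {T : (H.language N).Theory}
    (hT : IsModelCompletion.{0, 0, w} (H.baseTheory N) T) : TheoryEquiv T (H.genericTheory N) := by
  intro φ
  constructor
  · intro h
    obtain ⟨M, _, C, hC⟩ := exists_isGeneric.{w} N hH
    let := C.str N
    obtain ⟨K, _, _, hK, -⟩ := hT.exists_embedding hC.toIsBase.models
    have := models_genericTheory_of_isModelCompletion hH hT hK
    exact ((isComplete_genericTheory hH).realize_sentence_iff φ K).1 (h.realize_sentence K)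
  · intro h
    refine IsModelCompletion.modelsBoundedFormula_of_forall.{w} fun K _ _ hK => ?_
    have := models_genericTheory_of_isModelCompletion hH hT hK
    exact h.realize_sentence K

end HypergraphSeq

/-! ### Quantifier elimination and the limit -/

namespace FirstOrder.Language

variable {L : FirstOrder.Language.{u, v}}

/-- A formula whose truth in models of `T` depends only on finitely many quantifier-free formulas
is equivalent to a quantifier-free one. -/
theorem exists_isQF_iff_of_finite {T : L.Theory} {α : Type} {ι : Type*} [Finite ι]
    {Δ : ι → L.Formula α} (hΔ : ∀ i, BoundedFormula.IsQF (Δ i)) {φ : L.Formula α}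
    (h : ∀ (M₁ M₂ : Theory.ModelType.{u, v, max u v} T) (c : α → M₁) (d : α → M₂),
      (∀ i, (Δ i).Realize c ↔ (Δ i).Realize d) → φ.Realize c → φ.Realize d) :
    ∃ ψ : L.Formula α, BoundedFormula.IsQF ψ ∧ T ⊨ᵇ φ.iff ψ := by
  classical
  let good : Set (Set ι) := {S | ∃ (M : Theory.ModelType.{u, v, max u v} T) (c : α → M),
    S = {i | (Δ i).Realize c} ∧ φ.Realize c}
  let ψ : L.Formula α := BoundedFormula.iSup fun S : good =>
    BoundedFormula.iInf fun i : ι => if i ∈ S.1 then Δ i else ∼(Δ i)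
  have hψ : ∀ {M : Type (max u v)} [L.Structure M] (c : α → M),
      ψ.Realize c ↔ {i | (Δ i).Realize c} ∈ good := by
    intro M _ c
    have key : ∀ S : Set ι,
        (∀ i, BoundedFormula.Realize (if i ∈ S then Δ i else ∼(Δ i)) c default) ↔
          S = {i | (Δ i).Realize c} := by
      intro S
      rw [Set.ext_iff]
      refine forall_congr' fun i => ?_
      split_ifs with hi
      · simp only [hi, true_iff]
        rfl
      · simp only [hi, false_iff]
        rfl
    simp only [ψ, Formula.Realize, BoundedFormula.realize_iSup, BoundedFormula.realize_iInf, key]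
    constructor
    · rintro ⟨S, hS⟩
      exact hS ▸ S.2
    · exact fun hg => ⟨⟨_, hg⟩, rfl⟩
  refine ⟨ψ, HypergraphSeq.isQF_iSup fun S => HypergraphSeq.isQF_iInf fun i => ?_, ?_⟩
  · split_ifs
    · exact hΔ i
    · exact (hΔ i).not
  · intro M c xs
    rw [Subsingleton.elim xs default]
    refine BoundedFormula.realize_iff.2 ⟨fun hc => (hψ c).2 ⟨M, c, rfl, hc⟩, fun hc => ?_⟩
    obtain ⟨M', d, hd, hφ⟩ := (hψ c).1 hc
    refine h M' M d c (fun i => ?_) hφ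
    exact (Set.ext_iff.1 hd i).symm

end FirstOrder.Language

namespace HypergraphSeq

open FirstOrder.Language ColoredHypergraph

variable {r : ℕ} {H : HypergraphSeq r} {N : ℕ∞}

/-- The atomic formulas that determine whether tuples agree up to level `l`. -/
def atomFormula (V : Type) (l : ℕ) :
    (V × V) ⊕ (V × ∀ j : Fin l, Fin (H.size j)) ⊕ (Fin (r + 1) → V) → (H.language ⊤).Formula V
  | .inl p => Term.equal (Term.var p.1) (Term.var p.2)
  | .inr (.inl p) => Relations.formula (L := H.language ⊤)
      (Rel.Q (Node.ofFn l le_top p.2) : H.Rel ⊤ 1) fun _ => Term.var p.1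
  | .inr (.inr u) => Relations.formula (L := H.language ⊤)
      (Rel.R : H.Rel ⊤ (r + 1)) fun i => Term.var (u i)

theorem isQF_atomFormula {V : Type} {l : ℕ} (i) :
    BoundedFormula.IsQF (atomFormula (H := H) V l i) := by
  rcases i with p | p | u
  · exact (BoundedFormula.IsAtomic.equal _ _).isQF
  · exact (BoundedFormula.IsAtomic.rel _ _).isQF
  · exact (BoundedFormula.IsAtomic.rel _ _).isQF

theorem agree_of_atomFormula {V : Type} {l : ℕ} {M₁ : Type u} {M₂ : Type v}
    {C₁ : H.ColoredHypergraph M₁} {C₂ : H.ColoredHypergraph M₂} {c : V → M₁} {d : V → M₂}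
    (h : ∀ i, (letI := C₁.str ⊤; (atomFormula (H := H) V l i).Realize c) ↔
      (letI := C₂.str ⊤; (atomFormula (H := H) V l i).Realize d)) :
    Agree l C₁ C₂ (Set.range fun i => (c i, d i)) := by
  rw [agree_range_iff]
  refine ⟨fun i j => h (.inl (i, j)), fun i j hj => ?_, fun u => h (.inr (.inr u))⟩
  have := (h (.inr (.inl (i, fun j => C₁.color (c i) j)))).1 (QRel_ofFn_iff.2 fun _ => rfl)
  exact (QRel_ofFn_iff.1 this ⟨j, hj⟩).symm

/-- Since the hypergraphs of the template are finite, finitely many atomic formulas decide agreement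
up to the level that `φ` needs. -/
theorem eliminatesQuantifiers_genericTheory (hH : H.IsTemplate) :
    EliminatesQuantifiers (H.genericTheory ⊤) := by
  intro n φ
  obtain ⟨l, hl⟩ := exists_agree_level_formula.{0, 0} hH φ
  refine exists_isQF_iff_of_finite (Δ := atomFormula (Fin n) l) isQF_atomFormula ?_
  rintro @⟨M₁, _, hM₁, _⟩ @⟨M₂, _, hM₂, _⟩ c d h
  obtain ⟨C₁, h₁, rfl⟩ := exists_isGeneric_of_models hH hM₁
  obtain ⟨C₂, h₂, rfl⟩ := exists_isGeneric_of_models hH hM₂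
  exact (hl h₁ h₂ (Or.inl rfl) (agree_of_atomFormula h)).1

theorem exists_onBoundedFormula_eq {α : Type*} {n : ℕ} (φ : (H.language ⊤).BoundedFormula α n) :
    ∃ m₀ : ℕ, ∀ m ≥ m₀, ∃ ψ, (H.incl m).onBoundedFormula ψ = φ := by
  have hterm : ∀ {V : Type _} (m : ℕ) (t : (H.language ⊤).Term V),
      ∃ s, (H.incl m).onTerm s = t := by
    intro V m t
    obtain ⟨a, rfl⟩ := exists_eq_var t
    exact ⟨Term.var a, rfl⟩
  induction φ with
  | falsum => exact ⟨0, fun m _ => ⟨.falsum, rfl⟩⟩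
  | equal t₁ t₂ =>
    refine ⟨0, fun m _ => ?_⟩
    obtain ⟨s₁, rfl⟩ := hterm m t₁
    obtain ⟨s₂, rfl⟩ := hterm m t₂
    exact ⟨.equal s₁ s₂, rfl⟩
  | rel s ts =>
    change H.Rel ⊤ _ at s
    have hts : ∀ m : ℕ, ∃ ts' : _ → (H.language m).Term _, (fun i => (H.incl m).onTerm (ts' i)) = ts := fun m =>
      ⟨fun i => (hterm m (ts i)).choose, funext fun i => (hterm m (ts i)).choose_spec⟩
    cases s with
    | R =>
      refine ⟨0, fun m _ => ?_⟩
      obtain ⟨ts', rfl⟩ := hts m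
      exact ⟨.rel (L := H.language m) (Rel.R : H.Rel m (r + 1)) ts', rfl⟩
    | Q η =>
      refine ⟨η.1.length, fun m hm => ?_⟩
      obtain ⟨ts', rfl⟩ := hts m
      exact ⟨.rel (L := H.language m)
        (Rel.Q ⟨η.1, η.2.1, by exact_mod_cast hm⟩ : H.Rel m 1) ts', rfl⟩
  | imp φ₁ φ₂ ih₁ ih₂ =>
    obtain ⟨m₁, h₁⟩ := ih₁
    obtain ⟨m₂, h₂⟩ := ih₂
    refine ⟨max m₁ m₂, fun m hm => ?_⟩
    obtain ⟨ψ₁, rfl⟩ := h₁ m (le_of_max_le_left hm)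
    obtain ⟨ψ₂, rfl⟩ := h₂ m (le_of_max_le_right hm)
    exact ⟨ψ₁.imp ψ₂, rfl⟩
  | all φ ih =>
    obtain ⟨m₀, h⟩ := ih
    refine ⟨m₀, fun m hm => ?_⟩
    obtain ⟨ψ, rfl⟩ := h m hm
    exact ⟨ψ.all, rfl⟩

theorem incl_isExpansionOn {M : Type*} (C : H.ColoredHypergraph M) (m : ℕ) :
    letI := C.str m
    letI := C.str ⊤
    (H.incl m).IsExpansionOn M :=
  letI := C.str m
  letI := C.str ⊤
  { map_onFunction := fun f => Empty.elim f
    map_onRelation := fun {n} (s : H.Rel m n) => match n, s with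
      | _, .R => fun _ => rfl
      | _, .Q _ => fun _ => rfl }

theorem isLimit_genericTheory (hH : H.IsTemplate) (Tm : ∀ m : ℕ, (H.language m).Theory)
    (hTm : ∀ m : ℕ, IsModelCompletion.{0, 0, w} (H.baseTheory m) (Tm m)) :
    H.IsLimit Tm (H.genericTheory ⊤) := by
  intro φ
  obtain ⟨m₀, hm₀⟩ := exists_onBoundedFormula_eq φ
  obtain ⟨l, hl⟩ := exists_agree_level_formula.{0, 0} hH φ
  filter_upwards [eventually_ge_atTop (max m₀ l)] with m hm
  obtain ⟨ψ, hψ⟩ := hm₀ m (le_of_max_le_left hm)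
  refine ⟨ψ, hψ, ?_⟩
  obtain ⟨M₁, _, C₁, h₁⟩ := exists_isGeneric.{0} m hH
  obtain ⟨M₂, _, C₂, h₂⟩ := exists_isGeneric.{0} ⊤ hH
  let := C₁.str m
  -- The hypergraph `C₁` is generic of level `m` only, but it can be read in the full language. The
  -- back and forth comparison with `C₂` applies because `m` is at least `l`.
  let := C₁.str ⊤
  let := C₂.str ⊤
  have := incl_isExpansionOn C₁ m
  have hM₁ := h₁.models
  have hM₂ := h₂.models
  rw [theoryEquiv_of_isModelCompletion hH (hTm m) ψ,
    ← (isComplete_genericTheory hH).realize_sentence_iff ψ M₁,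
    ← (isComplete_genericTheory hH).realize_sentence_iff φ M₂,
    ← (H.incl m).realize_onSentence M₁ ψ]
  rw [show (H.incl m).onSentence ψ = φ from hψ]
  refine hl h₁ h₂ (Or.inr ⟨by exact_mod_cast le_of_max_le_right hm, le_top⟩)
    ⟨by rintro _ ⟨i, -⟩; exact i.elim, by rintro _ ⟨i, -⟩; exact i.elim,
      fun u hu => (hu 0).choose.elim⟩

end HypergraphSeq

namespace HypergraphSeq

open FirstOrder.Language

variable {r : ℕ} {H : HypergraphSeq r} {N : ℕ∞}

/-! ### Free amalgamation along a sequence of parameters -/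

/-- A weak form of the Δ-system lemma for sequences of tuples. -/
theorem exists_infinite_deltaSystem {M : Type*} {b : ℕ} (d : ℕ → Fin b → M) {I : Set ℕ}
    (hI : I.Infinite) : ∃ J ⊆ I, J.Infinite ∧ ∀ i ∈ J, ∀ i' ∈ J, i ≠ i' → ∀ p p',
      d i p = d i' p' → d i' p = d i' p' ∨ d i p = d i p' := by
  classical
  -- A maximal set `P` of coordinates that are constant along some infinite `J`. By maximality,
  -- every other coordinate takes each value only finitely often on `J`.
  let 𝓕 : Set (Finset (Fin b)) :=
    {P | ∃ J ⊆ I, J.Infinite ∧ ∀ p ∈ P, ∀ i ∈ J, ∀ i' ∈ J, d i p = d i' p}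
  obtain ⟨P, ⟨J, hJI, hJ, hPJ⟩, hmax⟩ := (Set.toFinite 𝓕).exists_maximal
    ⟨∅, I, subset_rfl, hI, by simp⟩
  have hfin : ∀ p ∉ P, ∀ v, {i ∈ J | d i p = v}.Finite := by
    intro p hp v
    by_contra hinf
    have hmem : insert p P ∈ 𝓕 := by
      refine ⟨{i ∈ J | d i p = v}, fun i hi => hJI hi.1, hinf, fun p' hp' i hi i' hi' => ?_⟩
      rcases Finset.mem_insert.1 hp' with rfl | hp'
      · exact hi.2.trans hi'.2.symm
      · exact hPJ p' hp' i hi.1 i' hi'.1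
    exact hp (hmax hmem (Finset.subset_insert p P) (Finset.mem_insert_self p P))
  -- Each index is chosen so that its coordinates outside `P` avoid all earlier values. A
  -- coincidence then involves a constant coordinate at the later index.
  obtain ⟨f, hfJ, hf⟩ := exists_seq_of_forall_finset_exists (· ∈ J)
    (fun i i' => i < i' ∧ ∀ p, ∀ p' ∉ P, d i p ≠ d i' p') (by
      intro s _
      have hbad : (⋃ i ∈ s, ⋃ p : Fin b, ⋃ p' ∈ Pᶜ, {i' ∈ J | d i' p' = d i p}).Finite :=
        s.finite_toSet.biUnion fun i _ => Set.finite_iUnion fun p =>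
          Pᶜ.finite_toSet.biUnion fun p' hp' => hfin p' (by simpa using hp') _
      obtain ⟨y, hyJ, hy⟩ := (hJ.sdiff (hbad.union (Set.finite_Iic (s.sup id)))).nonempty
      simp only [Set.mem_union, not_or, Set.mem_Iic, not_le] at hy
      refine ⟨y, hyJ, fun i hi => ⟨(Finset.le_sup (f := id) hi).trans_lt hy.2,
        fun p p' hp' hpp => hy.1 ?_⟩⟩
      simp only [Set.mem_iUnion]
      exact ⟨i, hi, p, p', by simpa using hp', hyJ, hpp.symm⟩)
  have hmono : StrictMono f := fun m n hmn => (hf m n hmn).1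
  refine ⟨Set.range f, ?_, Set.infinite_range_of_injective hmono.injective, ?_⟩
  · rintro _ ⟨n, rfl⟩
    exact hJI (hfJ n)
  · rintro _ ⟨m, rfl⟩ _ ⟨n, rfl⟩ hne p p' h
    rcases lt_trichotomy m n with hmn | rfl | hmn
    · have hp' : p' ∈ P := by
        by_contra hp'
        exact (hf m n hmn).2 p p' hp' h
      exact Or.inr (h.trans (hPJ p' hp' _ (hfJ n) _ (hfJ m)))
    · exact absurd rfl hne
    · have hp : p ∈ P := by
        by_contra hp
        exact (hf n m hmn).2 p' p hp h.symm
      exact Or.inl ((hPJ p hp _ (hfJ n) _ (hfJ m)).trans h)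

namespace ColoredHypergraph

/-- The entries of `x` outside `K` are replaced by copies in the right summand, and these get over
every `d i` the edges that `x` has over `c`. The prescriptions do not conflict: a prescribed tuple
that lies in `M` uses only points of `K` and `d i`, where agreement already decides it, and a tuple
prescribed for two indices comes from the same tuple of `x` and `c` by `hdelta`. The condition `hx`
ensures that no copied entry is a parameter, which would have to be every `d i` at once. -/
theorem exists_amalgam (hH : H.IsTemplate) {M : Type*} {C : H.ColoredHypergraph M}
    (hC : C.IsBase ⊤) {a b l : ℕ} {x : Fin a → M} {c : Fin b → M} {K : Set M} {ι : Type*}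
    {d : ι → Fin b → M}
    (hd : ∀ i, Agree l C C ((fun m => (m, m)) '' K ∪ Set.range fun p => (c p, d i p)))
    (hx : ∀ k p, x k = c p → x k ∈ K)
    (hdelta : ∀ i i', i ≠ i' → ∀ p p', d i p = d i' p' → d i' p = d i' p' ∨ d i p = d i p') :
    ∃ (C₁ : H.ColoredHypergraph (M ⊕ M)) (e : Fin a → M ⊕ M), C₁.IsBase l ∧
      Agree l C₁ C (Set.range fun m => (Sum.inl m, m)) ∧
      ∀ i, Agree l C C₁ (Set.range fun s => (Sum.elim x c s, Sum.elim e (Sum.inl ∘ d i) s)) := by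
  classical
  let z : Fin a ⊕ Fin b → M := Sum.elim x c
  let e : Fin a → M ⊕ M := fun k => if x k ∈ K then Sum.inl (x k) else Sum.inr (x k)
  let y : ι → Fin a ⊕ Fin b → M ⊕ M := fun i => Sum.elim e (Sum.inl ∘ d i)
  have he1 : ∀ k, x k ∈ K → e k = Sum.inl (x k) := fun k hk => by simp [e, hk]
  have he2 : ∀ k, x k ∉ K → e k = Sum.inr (x k) := fun k hk => by simp [e, hk]
  have hinl : ∀ i s m, y i s = Sum.inl m →
      (z s, m) ∈ (fun m => (m, m)) '' K ∪ Set.range fun p => (c p, d i p) := by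
    rintro i (k | p) m h
    · by_cases hk : x k ∈ K
      · have hm : e k = Sum.inl m := h
        rw [he1 k hk, Sum.inl.injEq] at hm
        exact Or.inl ⟨x k, hk, by simp [z, ← hm]⟩
      · have hm : e k = Sum.inl m := h
        simp [he2 k hk] at hm
    · have hm : d i p = m := Sum.inl_injective h
      exact Or.inr ⟨p, by simp [z, hm]⟩
  have hcases : ∀ i s, (∃ m, y i s = Sum.inl m) ∨ (y i s = Sum.inr (z s) ∧ z s ∉ K ∧
      ∃ k, s = Sum.inl k) := by
    rintro i (k | p)
    · by_cases hk : x k ∈ K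
      · exact Or.inl ⟨_, he1 k hk⟩
      · exact Or.inr ⟨he2 k hk, hk, k, rfl⟩
    · exact Or.inl ⟨_, rfl⟩
  -- Coincidences between `d i` and `d i'` for `i ≠ i'` are the critical case; `hdelta` reduces them
  -- to a coincidence within one tuple.
  have hyz : ∀ i s i' s', y i s = y i' s' → z s = z s' := by
    intro i s i' s' h
    rcases hcases i s with ⟨m, hm⟩ | ⟨hm, -⟩
    · have h1 := hinl i s m hm
      have h2 := hinl i' s' m (h ▸ hm)
      by_cases hii : i = i'
      · subst hii
        exact ((hd i).eq_iff _ h1 _ h2).2 rfl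
      · rcases h1 with ⟨m₁, hm₁, e₁⟩ | ⟨p₁, e₁⟩
        · obtain ⟨e₁, rfl⟩ := Prod.ext_iff.1 e₁
          exact ((hd i').eq_iff _ (Or.inl ⟨m₁, hm₁, Prod.ext e₁ rfl⟩) _ h2).2 rfl
        · rcases h2 with ⟨m₂, hm₂, e₂⟩ | ⟨p₂, e₂⟩
          · obtain ⟨e₂, rfl⟩ := Prod.ext_iff.1 e₂
            exact ((hd i).eq_iff _ (Or.inr ⟨p₁, e₁⟩) _ (Or.inl ⟨m₂, hm₂, Prod.ext e₂ rfl⟩)).2 rfl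
          · obtain ⟨e₁, e₁'⟩ := Prod.ext_iff.1 e₁
            obtain ⟨e₂, e₂'⟩ := Prod.ext_iff.1 e₂
            simp only at e₁ e₁' e₂ e₂'
            rw [← e₁, ← e₂]
            rcases hdelta i i' hii p₁ p₂ (e₁'.trans e₂'.symm) with h | h
            · exact ((hd i').eq_iff (c p₁, d i' p₁) (Or.inr ⟨p₁, rfl⟩) (c p₂, d i' p₂)
                (Or.inr ⟨p₂, rfl⟩)).2 h
            · exact ((hd i).eq_iff (c p₁, d i p₁) (Or.inr ⟨p₁, rfl⟩) (c p₂, d i p₂)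
                (Or.inr ⟨p₂, rfl⟩)).2 h
    · rcases hcases i' s' with ⟨m', hm'⟩ | ⟨hm', -⟩
      · rw [hm, hm'] at h
        cases h
      · rw [hm, hm'] at h
        exact Sum.inr_injective h
  have hzy : ∀ i s s', z s = z s' → y i s = y i s' := by
    intro i s s' h
    rcases hcases i s with ⟨m, hm⟩ | ⟨hm, hK, k, rfl⟩
    · rcases hcases i s' with ⟨m', hm'⟩ | ⟨hm', hK, k, rfl⟩
      · have hmm : m = m' := ((hd i).eq_iff _ (hinl i s m hm) _ (hinl i s' m' hm')).1 h
        rw [hm, hm', hmm]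
      · rcases s with k' | p
        · simp only [y, e, Sum.elim_inl]
          rw [show x k' = x k from h]
        · exact absurd (hx k p h.symm) hK
    · rcases s' with k' | p
      · simp only [y, e, Sum.elim_inl]
        rw [show x k = x k' from h]
      · exact absurd (hx k p h) hK
  -- The `d i` have the colors of `c` only below `l`, so the new edges might violate the template
  -- higher up. Cutting off the colors at `l` removes these constraints.
  let col : M → ∀ j, Fin (H.size j) := fun m j => if j < l then C.color m j else ⟨0, hH.size_pos j⟩
  let C₁ : H.ColoredHypergraph (M ⊕ M) :=
    { color := Sum.elim col col
      edge := fun t => (∃ t', t = Sum.inl ∘ t' ∧ C.edge t') ∨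
        ∃ i, ∃ u : Fin (r + 1) → Fin a ⊕ Fin b, t = y i ∘ u ∧ C.edge (z ∘ u) }
  have hcoly : ∀ i s, ∀ j < l, C₁.color (y i s) j = C.color (z s) j := by
    intro i s j hj
    rcases hcases i s with ⟨m, hm⟩ | ⟨hm, -⟩
    · rw [hm, (hd i).color _ (hinl i s m hm) j hj]
      simp [C₁, col, hj]
    · rw [hm]
      simp [C₁, col, hj]
  have hedgey : ∀ i (u : Fin (r + 1) → Fin a ⊕ Fin b) (t' : Fin (r + 1) → M),
      y i ∘ u = Sum.inl ∘ t' → (C.edge (z ∘ u) ↔ C.edge t') := fun i u t' h =>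
    (hd i).edge (fun k => (z (u k), t' k)) fun k => hinl i (u k) (t' k) (congrFun h k)
  refine ⟨C₁, e, ⟨?_, ?_, ?_, ?_⟩, ?_, fun i => ?_⟩
  · rintro σ t (⟨t', rfl, h⟩ | ⟨i, u, rfl, h⟩)
    · exact Or.inl ⟨t' ∘ σ, rfl, hC.symm σ _ h⟩
    · exact Or.inr ⟨i, u ∘ σ, rfl, hC.symm σ _ h⟩
  · rintro t (⟨t', rfl, h⟩ | ⟨i, u, rfl, h⟩)
    · exact Sum.inl_injective.comp (hC.inj _ h)
    · exact fun k k' hk => hC.inj _ h (hyz _ _ _ _ hk)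
  · rintro t (⟨t', rfl, h⟩ | ⟨i, u, rfl, h⟩) j hj
    · have hj' : j < l := by exact_mod_cast hj
      simpa [C₁, col, hj'] using hC.compat _ h j (ENat.natCast_lt_top j)
    · have hj' : j < l := by exact_mod_cast hj
      convert hC.compat _ h j (ENat.natCast_lt_top j) using 1
      funext k
      exact hcoly i (u k) j hj'
  · rintro (m | m) j hj <;>
    · have hj' : ¬ j < l := not_lt.2 (by exact_mod_cast hj)
      simp [C₁, col, hj']
  · rw [agree_range_iff]
    refine ⟨fun m m' => Sum.inl_injective.eq_iff, fun m j hj => by simp [C₁, col, hj], fun u => ?_⟩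
    constructor
    · rintro (⟨t', h, ht⟩ | ⟨i, v, h, hv⟩)
      · rwa [show u = t' from funext fun k => Sum.inl_injective (congrFun h k)]
      · exact (hedgey i v u h.symm).1 hv
    · exact fun h => Or.inl ⟨u, rfl, h⟩
  · rw [agree_range_iff]
    refine ⟨fun s s' => ⟨hzy i s s', hyz i s i s'⟩, fun s j hj => (hcoly i s j hj).symm,
      fun u => ⟨fun h => Or.inr ⟨i, u, rfl, h⟩, ?_⟩⟩
    rintro (⟨t', h, ht⟩ | ⟨i', v, h, hv⟩)
    · exact (hedgey i u t' h).2 ht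
    · rwa [show Sum.elim x c ∘ u = z ∘ v from
        funext fun k => hyz i (u k) i' (v k) (congrFun h k)]

/-- If `φ(x, c)` holds, where the entries of `x` that occur in `c` belong to `K`, then for any
sequence of tuples `d i` that look like `c` over `K`, some `q` many of the formulas `φ(x, d i)` are
jointly consistent. -/
theorem exists_realize_of_agree (hH : H.IsTemplate) {a b : ℕ}
    (φ : (H.language ⊤).Formula (Fin a ⊕ Fin b)) (q : ℕ) :
    ∃ l : ℕ, ∀ {M : Type w} {C : H.ColoredHypergraph M} {x : Fin a → M} {c : Fin b → M} {K : Set M}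
      {d : ℕ → Fin b → M} {I : Set ℕ}, C.IsGeneric ⊤ → I.Infinite →
      (∀ i ∈ I, Agree l C C ((fun m => (m, m)) '' K ∪ Set.range fun p => (c p, d i p))) →
      (∀ k p, x k = c p → x k ∈ K) →
      letI := C.str ⊤
      φ.Realize (Sum.elim x c) →
      ∃ s : Finset ℕ, ↑s ⊆ I ∧ s.card = q ∧ ∃ x' : Fin a → M,
        ∀ i ∈ s, φ.Realize (Sum.elim x' (d i)) := by
  obtain ⟨l₀, hl₀⟩ := exists_agree_level_formula.{w, w} hH φ
  obtain ⟨l₁, hl₁⟩ := hH.exists_hasJoins (q * b + a)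
  refine ⟨max l₀ l₁, fun {M C x c K d I} hC hI hd hx hφ => ?_⟩
  obtain ⟨J, hJI, hJ, hdelta⟩ := exists_infinite_deltaSystem d hI
  obtain ⟨s, hsJ, hs⟩ := hJ.exists_subset_card_eq q
  refine ⟨s, hsJ.trans hJI, hs, ?_⟩
  obtain ⟨C₁, e, hC₁, hinl, hagree⟩ := exists_amalgam hH (ι := s) (d := fun i => d i) hC.toIsBase
    (fun i => hd i (hJI (hsJ i.2))) hx
    fun i i' hne => hdelta i (hsJ i.2) i' (hsJ i'.2) fun h => hne (Subtype.ext h)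
  -- The amalgam is mapped back into `M`, fixing the `q * b` parameters and adding the `a` copied
  -- entries one at a time; hence the bound `q * b + a` on the joins.
  let S : Set ((M ⊕ M) × M) := Set.range fun p : s × Fin b => (Sum.inl (d p.1 p.2), d p.1 p.2)
  have hS : S.ncard ≤ q * b := by
    simp only [S]
    rw [← Set.image_univ]
    refine (Set.ncard_image_le Set.finite_univ).trans ?_
    rw [Set.ncard_univ, Nat.card_prod]
    simp [hs]
  obtain ⟨e', he'⟩ := hC.exists_agree_superset hC₁ (Or.inr ⟨le_rfl, le_top⟩) (Set.toFinite S)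
    (hinl.mono le_rfl (by rintro _ ⟨p, rfl⟩; exact ⟨_, rfl⟩)) (a := a) (n := q * b + a)
    (by omega) (hl₁.mono le_rfl (le_max_right l₀ l₁) le_rfl) e
  refine ⟨e', fun i hi => ?_⟩
  have h2 : Agree (max l₀ l₁) C₁ C
      (Set.range fun k => (Sum.elim e (Sum.inl ∘ d i) k, Sum.elim e' (d i) k)) := by
    refine he'.mono le_rfl ?_
    rintro _ ⟨k | p, rfl⟩
    · exact Or.inl ⟨k, rfl⟩
    · exact Or.inr ⟨(⟨i, hi⟩, p), rfl⟩
  exact (hl₀ hC hC (Or.inl rfl) (((hagree ⟨i, hi⟩).trans_range h2).mono (le_max_left _ _)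
    subset_rfl)).1 hφ

end ColoredHypergraph

end HypergraphSeq

/-! ### Simplicity and rank -/

namespace FirstOrder.Language

variable {L : FirstOrder.Language.{u, v}}

/-- As `x` lies in `A`, the truth of `φ(x, ·)` is part of the type over `A`, so `x` solves all
conjugates simultaneously. -/
theorem not_divides_of_forall_mem {N : Type w} [L.Structure N] {a b : ℕ} {A : Set N}
    {φ : L.Formula (Fin a ⊕ Fin b)} {d : Fin b → N} {x : Fin a → N} (hx : ∀ k, x k ∈ A)
    (hφ : φ.Realize (Sum.elim x d)) : ¬ L.Divides A φ d := by
  rintro ⟨N', _, g, q, c, hc, hinc⟩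
  refine hinc (Finset.range q) (Finset.card_range q) ⟨g ∘ x, fun i _ => ?_⟩
  let θ : L.Formula (g '' A ⊕ Fin b) :=
    φ.relabel (Sum.elim (fun k => Sum.inl ⟨g (x k), Set.mem_image_of_mem g (hx k)⟩) Sum.inr)
  have hθ : ∀ e : Fin b → N',
      θ.Realize (Sum.elim (fun a : g '' A => (a : N')) e) ↔ φ.Realize (Sum.elim (g ∘ x) e) := by
    intro e
    rw [Formula.realize_relabel]
    refine iff_of_eq (congrArg _ ?_)
    funext k
    rcases k with k | k <;> rfl
  have h1 := (g.map_formula φ (Sum.elim x d)).2 hφ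
  rw [Sum.comp_elim] at h1
  exact (hθ _).1 ((hc i θ).2 ((hθ _).2 h1))

theorem not_typeForks_of_mem {N : Type w} [L.Structure N] {A B : Set N} {c : N} (hc : c ∈ A) :
    ¬ L.TypeForks A B c := by
  rintro ⟨b, φ, d, -, hφ, N', _, g, n, b', ψ, e, hdiv, hcov⟩
  have h1 := (g.map_formula φ _).2 hφ
  rw [Sum.comp_elim] at h1
  obtain ⟨j, hj⟩ := hcov _ h1
  exact not_divides_of_forall_mem (fun _ => Set.mem_image_of_mem g hc) hj (hdiv j)

end FirstOrder.Language

namespace HypergraphSeq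

open FirstOrder.Language ColoredHypergraph

variable {r : ℕ} {H : HypergraphSeq r} {N : ℕ∞}

namespace ColoredHypergraph

/-- Pigeonhole: over a finite set there are only finitely many quantifier-free types up to level
`l`. -/
theorem exists_infinite_agree {M : Type*} (C : H.ColoredHypergraph M) (l : ℕ) {b : ℕ} {K : Set M}
    (hK : K.Finite) (d : ℕ → Fin b → M) :
    ∃ i₀, {i | Agree l C C ((fun m => (m, m)) '' K ∪ Set.range fun p => (d i₀ p, d i p))}.Infinite := by
  have := hK.to_subtype
  let t : ℕ → K ⊕ Fin b → M := fun i => Sum.elim (↑) (d i)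
  let F : ℕ → Set ((K ⊕ Fin b) × (K ⊕ Fin b)) × ((K ⊕ Fin b) → ∀ j : Fin l, Fin (H.size j)) ×
      Set (Fin (r + 1) → K ⊕ Fin b) := fun i =>
    ({s | t i s.1 = t i s.2}, fun s j => C.color (t i s) j, {u | C.edge (t i ∘ u)})
  obtain ⟨y, hy⟩ := Finite.exists_infinite_fiber F
  rw [Set.infinite_coe_iff] at hy
  obtain ⟨i₀, hi₀⟩ := hy.nonempty
  refine ⟨i₀, hy.mono fun i hi => ?_⟩
  have hF : F i₀ = F i := hi₀.trans hi.symm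
  obtain ⟨h1, h2, h3⟩ : _ ∧ _ ∧ _ := by simpa only [F, Prod.mk.injEq] using hF
  have : Agree l C C (Set.range fun s => (t i₀ s, t i s)) := agree_range_iff.2
    ⟨fun s s' => Set.ext_iff.1 h1 (s, s'), fun s j hj => congrFun (congrFun h2 s) ⟨j, hj⟩,
      fun u => Set.ext_iff.1 h3 u⟩
  refine this.mono le_rfl ?_
  rintro _ (⟨m, hm, rfl⟩ | ⟨p, rfl⟩)
  · exact ⟨Sum.inl ⟨m, hm⟩, rfl⟩
  · exact ⟨Sum.inr p, rfl⟩

end ColoredHypergraph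

theorem isSimpleTheory_genericTheory (hH : H.IsTemplate) :
    IsSimpleTheory.{0, 0, w} (H.genericTheory ⊤) := by
  rintro a b φ ⟨@⟨M, _, hM, _⟩, p, q, hinc, hcons⟩
  obtain ⟨C, hC, rfl⟩ := exists_isGeneric_of_models hH hM
  obtain ⟨l, hl⟩ := exists_realize_of_agree.{w} hH φ q
  let K : List ℕ → Set M := fun η => {m | ∃ ν, ν <+: η ∧ m ∈ Set.range (p ν)}
  have hK : ∀ η, (K η).Finite := by
    intro η
    have : K η = ⋃ ν ∈ {ν | ν ∈ η.inits}, Set.range (p ν) := by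
      ext m
      simp [K]
    rw [this]
    exact (List.finite_toSet η.inits).biUnion fun ν _ => Set.finite_range _
  -- The branch moves at each node to a successor that has infinitely many lookalike siblings over
  -- the parameters met so far.
  choose next hnext using fun η => exists_infinite_agree C l (hK η) fun i => p (η ++ [i])
  let path : ℕ → List ℕ := fun n => Nat.rec [] (fun _ η => η ++ [next η]) n
  have hpath : ∀ n, path (n + 1) = path n ++ [next (path n)] := fun _ => rfl
  have hofFn : ∀ n, (List.ofFn fun i : Fin n => next (path i)) = path n := by
    intro n
    induction n with
    | zero => rfl
    | succ n ih =>
      rw [List.ofFn_succ', hpath, List.concat_eq_append]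
      simpa using ih
  have hprefix : ∀ m n, m ≤ n → path m <+: path n := by
    intro m n hmn
    induction hmn with
    | refl => exact List.prefix_rfl
    | step _ ih => exact ih.trans (List.prefix_append _ _)
  obtain ⟨x, hx⟩ := hcons (fun j => next (path j)) (a + 1)
  simp only [hofFn] at hx
  -- A failure at `j` uses up an entry of `x`, which belongs to `K` ever after. With `a` entries
  -- there are at most `a` failures.
  obtain ⟨j, hj, hxj⟩ : ∃ j < a + 1, ∀ k s, x k = p (path (j + 1)) s → x k ∈ K (path j) := by
    by_contra! hne
    choose k s hk hkK using fun j : Fin (a + 1) => hne j j.2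
    have hlt : ∀ j j' : Fin (a + 1), j < j' → k j ≠ k j' := by
      intro j j' hjj h
      refine hkK j' ⟨path (j + 1), hprefix _ _ hjj, ?_⟩
      rw [← h, hk j]
      exact ⟨_, rfl⟩
    have hinj : Function.Injective k := by
      intro j j' h
      rcases lt_trichotomy j j' with h' | h' | h'
      · exact absurd h (hlt _ _ h')
      · exact h'
      · exact absurd h.symm (hlt _ _ h')
    simpa using Fintype.card_le_of_injective k hinj
  obtain ⟨s, -, hs, x', hx'⟩ := hl hC (hnext (path j)) (fun i hi => hi) hxj (hx j hj)
  exact hinc (path j) s hs ⟨x', hx'⟩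

/-- Free amalgamation with `K = ∅`: since `x` avoids `d`, all of its entries may be copied. -/
theorem not_divides_of_forall_ne (hH : H.IsTemplate) {M : Type w} [(H.language ⊤).Structure M]
    (hM : M ⊨ H.genericTheory ⊤) {a b : ℕ} {A : Set M} {φ : (H.language ⊤).Formula (Fin a ⊕ Fin b)}
    {d : Fin b → M} {x : Fin a → M} (hx : ∀ k p, x k ≠ d p) (hφ : φ.Realize (Sum.elim x d)) :
    ¬ (H.language ⊤).Divides A φ d := by
  rintro ⟨M', _, g, q, c, hc, hinc⟩
  have hM' := (g.theory_model_iff (H.genericTheory ⊤)).1 hM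
  obtain ⟨C, hC, rfl⟩ := exists_isGeneric_of_models hH hM'
  obtain ⟨l, hl⟩ := exists_realize_of_agree.{w} hH φ q
  let := C.str ⊤
  have h1 := (g.map_formula φ (Sum.elim x d)).2 hφ
  rw [Sum.comp_elim] at h1
  obtain ⟨s, -, hs, x', hx'⟩ := hl (K := ∅) (d := c) (I := Set.univ) hC Set.infinite_univ
    (fun i _ => by
      rw [Set.image_empty, Set.empty_union]
      refine agree_of_realize_qf hC.toIsBase hC.toIsBase (fun θ _ hθ => ?_) l
      have := (hc i (θ.relabel Sum.inr)).2
      rw [Formula.realize_relabel, Formula.realize_relabel] at this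
      exact this hθ)
    (fun k p h => absurd (g.injective h) (hx k p)) h1
  exact hinc s hs ⟨x', hx'⟩

/-- If `c ∉ B`, then genericity provides a solution of `φ` that avoids all parameters of the
dividing formulas. It satisfies one of them, which then cannot divide. -/
theorem mem_of_typeForks (hH : H.IsTemplate) {M : Type w} [(H.language ⊤).Structure M]
    (hM : M ⊨ H.genericTheory ⊤) {A B : Set M} {c : M} (h : (H.language ⊤).TypeForks A B c) :
    c ∈ B := by
  classical
  by_contra hcB
  obtain ⟨b, φ, d, hd, hφ, M', _, g, n, b', ψ, e, hdiv, hcov⟩ := h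
  have hM' := (g.theory_model_iff (H.genericTheory ⊤)).1 hM
  obtain ⟨C', hC', e'⟩ := exists_isGeneric_of_models hH hM'
  obtain ⟨C, hC, rfl⟩ := exists_isGeneric_of_models hH hM
  obtain ⟨l, hl⟩ := exists_agree_level_formula.{w, w} hH φ
  let S : Set (M × M') := Set.range fun i => (d i, g (d i))
  let F : Finset M' := Finset.univ.biUnion fun j => Finset.univ.image (e j)
  obtain ⟨l', hl'⟩ := hH.exists_hasJoins (S.ncard + F.card)
  subst e'
  let := C.str ⊤
  let := C'.str ⊤
  obtain ⟨y, hyF, hy⟩ := hC'.exists_agree_insert_avoiding hC.toIsBase (Or.inl rfl) (Set.toFinite S)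
    (agree_of_realize_qf hC.toIsBase hC'.toIsBase
      (fun θ _ hθ => (g.map_formula θ d).2 hθ) (max l l')) F le_rfl
    (hl'.mono le_rfl (le_max_right l l') le_rfl) (x := c)
    (by
      rintro _ ⟨i, rfl⟩ rfl
      exact hcB (hd i))
  have hφy : (letI := C'.str ⊤; φ.Realize (Sum.elim (fun _ : Fin 1 => y) (g ∘ d))) := by
    refine (hl hC hC' (Or.inl rfl) (hy.mono (le_max_left l l') ?_)).1 hφ
    rintro _ ⟨k | i, rfl⟩
    · exact Or.inl rfl
    · exact Or.inr ⟨i, rfl⟩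
  obtain ⟨j, hj⟩ := hcov _ hφy
  exact not_divides_of_forall_ne hH hM'
    (fun _ p hp => hyF (Finset.mem_biUnion.2 ⟨j, Finset.mem_univ j, by simp [hp]⟩)) hj (hdiv j)

/-- After the first forking `c₁` belongs to `B₁`, so its type over `B₁` contains an equation and
every realization of it stays in the base set. Such a type does not fork again. -/
theorem not_suRankGE_two (hH : H.IsTemplate) {M : Type w} [(H.language ⊤).Structure M]
    (hM : M ⊨ H.genericTheory ⊤) (A : Set M) (c : M) : ¬ (H.language ⊤).SURankGE 2 M A c := by
  rintro ⟨M₁, _, f₁, B₁, c₁, -, -, hfork₁, M₂, _, f₂, B₂, c₂, -, hsame, hfork₂, -⟩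
  have hM₁ := (f₁.theory_model_iff (H.genericTheory ⊤)).1 hM
  have hc₁ := mem_of_typeForks hH hM₁ hfork₁
  have hc₂ : c₂ = f₂ c₁ :=
    (hsame (Term.equal (Term.var (Sum.inr 0))
      (Term.var (Sum.inl ⟨f₂ c₁, Set.mem_image_of_mem f₂ hc₁⟩)))).2 rfl
  exact not_typeForks_of_mem (hc₂ ▸ Set.mem_image_of_mem f₂ hc₁) hfork₂

variable (H) in
/-- Infinitely many vertices of the same color, without edges. -/
def discreteHypergraph (hH : H.IsTemplate) : H.ColoredHypergraph (ULift.{w} ℕ) :=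
  ⟨fun _ j => ⟨0, hH.size_pos j⟩, fun _ => False⟩

theorem isBase_discreteHypergraph (hH : H.IsTemplate) : (H.discreteHypergraph hH).IsBase N where
  symm := fun _ _ h => h
  inj := fun _ h => h.elim
  compat := fun _ h => h.elim
  zero := fun _ _ _ => rfl

/-- Infinitely many vertices of the same color all have the same type over `∅`, because a single
vertex carries no edge. Hence `x = c 0` divides over `∅`, as two different conjugates are
inconsistent. -/
theorem exists_suRankGE_one (hH : H.IsTemplate) :
    ∃ (M : Theory.ModelType.{0, 0, w} (H.genericTheory ⊤)) (c : M),
      (H.language ⊤).SURankGE 1 M ∅ c := by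
  let M := H.GenericExt ⊤ (ULift.{w} ℕ)
  let C : H.ColoredHypergraph M := GenericExt.coloredHypergraph ⊤ (H.discreteHypergraph hH)
  have hC : C.IsGeneric ⊤ := GenericExt.isGeneric hH (isBase_discreteHypergraph hH)
  let := C.str ⊤
  have hne : Nonempty M := ⟨.base ⟨0⟩⟩
  let c : ℕ → M := fun i => .base ⟨i⟩
  have hc : Function.Injective c := fun i j h => by
    simpa using GenericExt.base_injective h
  have hr : 2 ≤ r + 1 := hH.choose_spec.two_le_arity
  have hagree : ∀ (i : ℕ) (l : ℕ), Agree l C C {(c i, c 0)} := by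
    have hconst : ∀ m : M, ¬ C.edge fun _ => m := by
      intro m hm
      have := hC.inj _ hm (a₁ := ⟨0, by omega⟩) (a₂ := ⟨1, by omega⟩) rfl
      simp at this
    intro i l
    refine ⟨by rintro _ rfl _ rfl; simp, by rintro _ rfl j _; rfl, fun u hu => ?_⟩
    obtain rfl : u = fun _ => (c i, c 0) := funext hu
    exact iff_of_false (hconst _) (hconst _)
  let φ : (H.language ⊤).Formula (Fin 1 ⊕ Fin 1) :=
    Term.equal (Term.var (Sum.inl 0)) (Term.var (Sum.inr 0))
  have hdiv : ∀ A : Set M, A = ∅ → (H.language ⊤).Divides A φ fun _ => c 0 := by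
    rintro _ rfl
    refine ⟨M, C.str ⊤, ElementaryEmbedding.refl _ _, 2, fun i _ => c i, fun i θ => ?_, ?_⟩
    · refine realize_iff_of_agree hH θ hC hC fun l => (hagree i l).mono le_rfl ?_
      rintro _ ⟨⟨_, m, hm, -⟩ | k, rfl⟩
      · exact absurd hm (Set.notMem_empty m)
      · rfl
    · rintro s hs ⟨x, hx⟩
      obtain ⟨i, j, hij, rfl⟩ := Finset.card_eq_two.1 hs
      have h1 : x 0 = c i := hx i (by simp)
      have h2 : x 0 = c j := hx j (by simp)
      exact hij (hc (h1.symm.trans h2))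
  refine ⟨hC.models.bundled, c 0, M, C.str ⊤, ElementaryEmbedding.refl _ _, {c 0}, c 0,
    Set.image_subset_iff.2 (Set.empty_subset _),
    fun _ => Iff.rfl, ⟨1, φ, fun _ => c 0, fun _ => rfl, rfl, M, C.str ⊤,
      ElementaryEmbedding.refl _ _, 1, fun _ => 1, fun _ => φ, fun _ _ => c 0, fun _ =>
        hdiv _ (by rw [Set.image_empty]; exact Set.image_empty _), fun x hx => ⟨0, hx⟩⟩, trivial⟩

end HypergraphSeq

theorem mainTheorem1 (r : ℕ) (H : HypergraphSeq r) (hH : H.IsTemplate) :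
    ∃ T : (H.language ⊤).Theory,
      FirstOrder.Language.IsModelCompletion.{0, 0, w} (H.baseTheory ⊤) T ∧
      (∀ T' : (H.language ⊤).Theory,
        FirstOrder.Language.IsModelCompletion.{0, 0, w} (H.baseTheory ⊤) T' → FirstOrder.Language.TheoryEquiv T' T) ∧
      FirstOrder.Language.EliminatesQuantifiers T ∧
      FirstOrder.Language.IsSimpleTheory.{0, 0, w} T ∧
      FirstOrder.Language.HasSURank.{0, 0, w} T 1 ∧
      (∀ m : ℕ, ∃ S : (H.language m).Theory,
        FirstOrder.Language.IsModelCompletion.{0, 0, w} (H.baseTheory m) S) ∧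
      ∀ Tm : ∀ m : ℕ, (H.language m).Theory,
        (∀ m : ℕ, FirstOrder.Language.IsModelCompletion.{0, 0, w} (H.baseTheory m) (Tm m)) →
          H.IsLimit Tm T := by
  exact ⟨H.genericTheory ⊤, H.isModelCompletion_genericTheory hH,
    fun _ => H.theoryEquiv_of_isModelCompletion hH, H.eliminatesQuantifiers_genericTheory hH,
    H.isSimpleTheory_genericTheory hH,
    ⟨H.exists_suRankGE_one hH, fun M c => H.not_suRankGE_two hH M.is_model ∅ c⟩,
    fun m => ⟨H.genericTheory m, H.isModelCompletion_genericTheory hH⟩,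
    H.isLimit_genericTheory hH⟩
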